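/- Let $p$ be a prime number, let $\mathbb{C}_p$ be the completion of an algebraic closure of $\mathbb{Q}_p$ with $|p|_p=p^{-1}$, and fix an embedding $\overline{\mathbb{Q}}\hookrightarrow\mathbb{C}_p$. For $n\ge 1$ let $\mathrm{Res}(t^{n}-1,f(t))=\prod_{\zeta^{n}=1}f(\zeta)$ be the $n$-th cyclic resultant of $f$. For an integer $x\neq 0$ its non-$p$ part is $x\,|x|_p$. For $a\in\mathbb{C}_p$ with $|a-1|_p<1$ put $\log a=\sum_{n\ge1}-(1-a)^n/n$. Let $0\neq f(t)\in\mathbb{Z}[t]$, let $p^\mu$ be the maximal power of $p$ dividing $f(t)$, and write $f(t)=a_0\prod_i(t-\alpha_i)$ in $\overline{\mathbb{Q}}[t]$. Then $\bigl|p^{-\mu}a_0\prod_{|\alpha_j|_p>1}\alpha_j\bigr|_p=1$; there is a unique root of unity $\xi\in\mathbb{C}_p$ of order prime to $p$ with $\bigl|p^{-\mu}a_0\prod_{|\alpha_j|_p>1}\alpha_j-\xi\bigr|_p<1$; and for each $i$ with $|\alpha_i|_p=1$ there is a unique root of unity $\zeta_i\in\mathbb{C}_p$ of order prime to $p$ with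 $|\alpha_i-\zeta_i|_p<1$. Moreover, the following hold. (1) (i) If $p\mid f(t)$, then $\lim_{n\to\infty}\mathrm{Res}(t^{p^n}-1,f(t))=0$ in $\mathbb{Z}_p$. (ii) If $p\nmid f(t)$, then $\mathrm{Res}(t^{p^n}-1,f(t))$ converges in $\mathbb{Z}_p$ and $$\lim_{n\to\infty}\mathrm{Res}(t^{p^n}-1,f(t))=(-1)^{p\deg f+\#\{i\,\mid\,|\alpha_i|_p<1\}}\,\xi\prod_{i;\,|\alpha_i|_p=1}(\zeta_i-1);$$ this limit is zero if and only if $\zeta_i=1$ for some $i$ with $|\alpha_i|_p=1$. (2) Suppose that $\mathrm{Res}(t^{p^n}-1,f(t))\neq0$ for all $n\ge 0$. Then there is a unique $\nu\in\mathbb{Z}$ with $p^{-\nu}=\prod_{i;\,|\alpha_i-1|_p<1}|\log\alpha_i|_p$, and the non-$p$ part of $\mathrm{Res}(t^{p^n}-1,f(t))$ converges in $\mathbb{Z}_p$, as $n\to\infty$, to $$(-1)^{p\deg f+\#\{i\,\mid\,|\alpha_i|_p<1\}}\,\xi\,\Bigl(\prod_{\substack{i;\,|\alpha_i|_p=1,\\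 |\alpha_i-1|_p=1}}(\zeta_i-1)\Bigr)\,p^{-\nu}\prod_{\substack{i;\,|\alpha_i|_p=1,\\ |\alpha_i-1|_p<1}}\log\alpha_i.$$ If all $\alpha_i$ with $|\alpha_i-1|_p<1$ satisfy $|\alpha_i-1|_p<p^{-1/(p-1)}$, then $p^{\nu}=|p^{-\mu}f(1)|_p^{-1}$ (so $p^\nu=|f(1)|_p^{-1}$ when $p\nmid f(t)$). Finally, with $\lambda=\#\{i\mid|\alpha_i-1|_p<1\}$, the numbers $\lambda,\mu,\nu$ are the Iwasawa invariants of $f(t)$, that is, $|\mathrm{Res}(t^{p^n}-1,f(t))|_p^{-1}=p^{\lambda n+\mu p^n+\nu}$ for all sufficiently large $n$. -/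

import Mathlib

open Polynomial Filter Topology

noncomputable section

/-- The `n`-th cyclic resultant `Res(t^n - 1, f(t))`, the determinant of the Sylvester matrix. -/
def cyclicResultant (n : ℕ) (f : ℤ[X]) : ℤ :=
  resultant (X ^ n - 1 : ℤ[X]) f

/-- The non-`p` part of an integer: `m` for `x = m * p ^ r` with `p ∤ m` (and `0` for `x = 0`). -/
def nonPPart (p : ℕ) (x : ℤ) : ℤ :=
  x / (p : ℤ) ^ padicValInt p x

/-- The `p`-adic logarithm `log (1 + x) = ∑_{n ≥ 1} -(-x)^n / n`, used for `‖x‖ < 1`. -/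
def padicComplexLog (p : ℕ) [Fact p.Prime] (a : ℂ_[p]) : ℂ_[p] :=
  ∑' n : ℕ, -(-(a - 1)) ^ (n + 1) / ((n + 1 : ℕ) : ℂ_[p])

/-- `ζ` is a root of unity of order prime to `p` with `|a - ζ|_p < 1`. -/
def IsTeichmullerRep (p : ℕ) [Fact p.Prime] (a ζ : ℂ_[p]) : Prop :=
  IsOfFinOrder ζ ∧ (orderOf ζ).Coprime p ∧ ‖a - ζ‖ < 1

/-- `lam, mu, nu` are the Iwasawa invariants of `f`:
`|Res(t^(p^n) - 1, f(t))|_p⁻¹ = p^(lam * n + mu * p^n + nu)` for all large `n`. -/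
def IsIwasawaInvariants (p : ℕ) [Fact p.Prime] (f : ℤ[X]) (lam mu : ℕ) (nu : ℤ) : Prop :=
  ∀ᶠ n : ℕ in atTop,
    ‖((cyclicResultant (p ^ n) f : ℤ) : ℚ_[p])‖⁻¹ =
      (p : ℝ) ^ ((lam : ℤ) * (n : ℤ) + (mu : ℤ) * (p : ℤ) ^ n + nu)

end

/-!
Write `f = p^μ g` with `p ∤ g`. By Gauss's lemma `c = p^(-μ) a₀ ∏_{|α_i|>1} α_i` is a unit, and
the reduction of `g` is `± c̄ t^m ∏_{|α_i|=1} (t - ᾱ_i)`. It has coefficients in `𝔽_p`, so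
Frobenius fixes `c̄` and permutes the `ᾱ_i`. Hence all of them are algebraic over `𝔽_p` and have
Teichmüller representatives `ξ`, `ζ_i`, with `ξ^p = ξ` and with `z ↦ z^p` permuting the `ζ_i`.

Split `Res(t^(p^n) - 1, g) = ± b^(p^n) ∏ (α_i^(p^n) - 1)`, with `b` the leading coefficient of
`g`, by the size of the roots. Large roots combine with `b` to `c^(p^n) → ξ`, and each small root
contributes `-1`. For unit roots `α_i^(p^n) - ζ_i^(p^n) → 0`, and `∏ (ζ_i^(p^n) - 1)` does not
depend on `n` because taking `p`-th powers permutes its factors. A root congruent to `1` satisfies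
`(α_i^(p^n) - 1) / p^n → log α_i`, so dividing the resultant by `p^(n λ)` gives a convergent
sequence; its limit is nonzero because `log` vanishes only at roots of unity of `p`-power order.
Since an ultrametric norm is locally constant away from `0`, the norm of the limit is that of a
term, `p^(-ν)`.
-/

section Ultrametric

variable {K : Type*} [NormedField K]

theorem tendsto_prod_sub_prod_zero {ι β : Type*} {l : Filter β} (s : Finset ι) {x y : ι → β → K}
    (hx : ∀ i ∈ s, ∀ n, ‖x i n‖ ≤ 1) (hy : ∀ i ∈ s, ∀ n, ‖y i n‖ ≤ 1)
    (h : ∀ i ∈ s, Tendsto (fun n => x i n - y i n) l (𝓝 0)) :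
    Tendsto (fun n => ∏ i ∈ s, x i n - ∏ i ∈ s, y i n) l (𝓝 0) := by
  classical
  induction s using Finset.induction_on with
  | empty => simpa using tendsto_const_nhds
  | insert a s ha ih =>
    simp only [Finset.forall_mem_insert] at hx hy h
    have hleft : Tendsto (fun n => (∏ i ∈ s, x i n - ∏ i ∈ s, y i n) * x a n) l (𝓝 0) :=
      (ih hx.2 hy.2 h.2).zero_mul_isBoundedUnder_le (isBoundedUnder_of ⟨1, hx.1⟩)
    have hbound (n : β) : ‖∏ i ∈ s, y i n‖ ≤ 1 := by
      rw [norm_prod]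
      exact Finset.prod_le_one (fun _ _ => norm_nonneg _) fun i hi => hy.2 i hi n
    have hright : Tendsto (fun n => (x a n - y a n) * ∏ i ∈ s, y i n) l (𝓝 0) :=
      h.1.zero_mul_isBoundedUnder_le (isBoundedUnder_of ⟨1, hbound⟩)
    have hadd := hleft.add hright
    rw [add_zero] at hadd
    refine hadd.congr fun n => ?_
    rw [Finset.prod_insert ha, Finset.prod_insert ha]
    ring

variable [IsUltrametricDist K]

theorem norm_eq_of_norm_sub_lt {x y : K} (h : ‖x - y‖ < ‖y‖) : ‖x‖ = ‖y‖ := by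
  have hmax := IsUltrametricDist.norm_add_eq_max_of_norm_ne_norm h.ne
  rwa [sub_add_cancel, max_eq_right h.le] at hmax

theorem eventually_norm_eq_of_tendsto {β : Type*} {l : Filter β} {u : β → K} {x : K}
    (hu : Tendsto u l (𝓝 x)) (hx : x ≠ 0) : ∀ᶠ n in l, ‖u n‖ = ‖x‖ :=
  ((tendsto_iff_norm_sub_tendsto_zero.mp hu).eventually_lt_const (norm_pos_iff.mpr hx)).mono
    fun _ => norm_eq_of_norm_sub_lt

theorem norm_sub_lt_one_trans {x y z : K} (hxy : ‖x - y‖ < 1) (hyz : ‖y - z‖ < 1) :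
    ‖x - z‖ < 1 := by
  rw [← sub_add_sub_cancel x y z]
  exact (IsUltrametricDist.norm_add_le_max _ _).trans_lt (max_lt hxy hyz)

theorem norm_sub_one_of_norm_lt_one {x : K} (hx : ‖x‖ < 1) : ‖x - 1‖ = 1 := by
  simpa using norm_eq_of_norm_sub_lt (x := x - 1) (y := -1) (by simpa using hx)

theorem norm_sub_one_of_one_lt_norm {x : K} (hx : 1 < ‖x‖) : ‖x - 1‖ = ‖x‖ :=
  norm_eq_of_norm_sub_lt (by simpa using hx)

theorem norm_eq_one_of_norm_sub_one_lt_one {x : K} (hx : ‖x - 1‖ < 1) : ‖x‖ = 1 := by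
  simpa using norm_eq_of_norm_sub_lt (y := (1 : K)) (by simpa using hx)

theorem norm_sub_one_le_one {x : K} (hx : ‖x‖ ≤ 1) : ‖x - 1‖ ≤ 1 := by
  simpa [sub_eq_add_neg, hx] using IsUltrametricDist.norm_add_le_max x (-1)

theorem norm_pow_sub_pow_lt_one {x y : K} (hx : ‖x‖ ≤ 1) (hy : ‖y‖ ≤ 1) (h : ‖x - y‖ < 1)
    (n : ℕ) : ‖x ^ n - y ^ n‖ < 1 := by
  have hsum : ‖∑ i ∈ Finset.range n, x ^ i * y ^ (n - 1 - i)‖ ≤ 1 := by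
    refine IsUltrametricDist.norm_sum_le_of_forall_le_of_nonneg zero_le_one fun i _ => ?_
    rw [norm_mul, norm_pow, norm_pow]
    exact mul_le_one₀ (pow_le_one₀ (norm_nonneg _) hx) (by positivity)
      (pow_le_one₀ (norm_nonneg _) hy)
  rw [← (Commute.all x y).geom_sum₂_mul n, norm_mul]
  exact mul_lt_one_of_nonneg_of_lt_one_right hsum (norm_nonneg _) h

end Ultrametric

section PadicAlgebra

variable (K : Type*) [NormedField K] (p : ℕ) [hp : Fact p.Prime] [NormedAlgebra ℚ_[p] K]

theorem norm_intCast_eq_padicNorm (z : ℤ) : ‖(z : K)‖ = ‖(z : ℚ_[p])‖ := by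
  rw [← map_intCast (algebraMap ℚ_[p] K), norm_algebraMap']

theorem norm_natCast_eq_padicNorm (n : ℕ) : ‖(n : K)‖ = ‖(n : ℚ_[p])‖ := by
  rw [← map_natCast (algebraMap ℚ_[p] K), norm_algebraMap']

theorem norm_prime_eq_inv : ‖(p : K)‖ = (p : ℝ)⁻¹ := by
  rw [norm_natCast_eq_padicNorm K p, Padic.norm_p]

theorem norm_prime_lt_one : ‖(p : K)‖ < 1 := by
  rw [norm_natCast_eq_padicNorm K p]
  exact Padic.norm_p_lt_one

theorem prime_ne_zero : (p : K) ≠ 0 := by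
  rw [← norm_ne_zero_iff, norm_prime_eq_inv K p]
  exact inv_ne_zero (by exact_mod_cast hp.out.ne_zero)

theorem charZero_of_normedAlgebra_padic (p : ℕ) [Fact p.Prime] [NormedAlgebra ℚ_[p] K] :
    CharZero K :=
  charZero_of_injective_algebraMap (algebraMap ℚ_[p] K).injective

theorem norm_natCast_inv_le (p : ℕ) [Fact p.Prime] [NormedAlgebra ℚ_[p] K] {k : ℕ}
    (hk : k ≠ 0) : ‖(k : K)⁻¹‖ ≤ k := by
  rw [norm_inv, norm_natCast_eq_padicNorm K p,
    Padic.norm_eq_zpow_neg_valuation (Nat.cast_ne_zero.mpr hk), Padic.valuation_natCast,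
    ← zpow_neg, neg_neg, zpow_natCast]
  exact_mod_cast Nat.le_of_dvd (Nat.pos_of_ne_zero hk) pow_padicValNat_dvd

end PadicAlgebra

section Radius

variable {p : ℕ} [hp : Fact p.Prime] {x : ℝ}

theorem lt_one_of_pow_pred_lt_inv (hx : 0 ≤ x) (h : x ^ (p - 1) < (p : ℝ)⁻¹) : x < 1 :=
  (pow_lt_one_iff_of_nonneg hx (Nat.sub_ne_zero_of_lt hp.out.one_lt)).mp
    (h.trans_le (inv_le_one_of_one_le₀ (by exact_mod_cast hp.out.one_le)))

theorem pow_pred_lt_inv_of_lt_rpow (hx : 0 ≤ x) (h : x < (p : ℝ) ^ (-1 / ((p : ℝ) - 1))) :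
    x ^ (p - 1) < (p : ℝ)⁻¹ := by
  have hp1 : (1 : ℝ) < p := by exact_mod_cast hp.out.one_lt
  calc x ^ (p - 1) < ((p : ℝ) ^ (-1 / ((p : ℝ) - 1))) ^ (p - 1) :=
        pow_lt_pow_left₀ h hx (Nat.sub_ne_zero_of_lt hp.out.one_lt)
    _ = (p : ℝ)⁻¹ := by
      rw [← Real.rpow_natCast, ← Real.rpow_mul (by positivity), Nat.cast_pred hp.out.pos,
        div_mul_cancel₀ _ (sub_ne_zero.mpr hp1.ne'), Real.rpow_neg_one]

end Radius

section PadicLog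

variable {K : Type*} [NormedField K]

/-- The logarithmic series `log a = ∑_{n ≥ 1} -(1 - a)^n / n` in an arbitrary normed field, with
junk value `0` where it diverges; over `ℂ_[p]` it is `padicComplexLog p`. -/
noncomputable def padicLog (a : K) : K :=
  ∑' k : ℕ, -(-(a - 1)) ^ (k + 1) / ((k + 1 : ℕ) : K)

variable (p : ℕ) [hp : Fact p.Prime] [NormedAlgebra ℚ_[p] K]

variable (K) in
theorem choose_prime_pow_succ_eq (n k : ℕ) :
    ((p ^ n).choose (k + 1) : K) = (p : K) ^ n * (p ^ n - 1).choose k / ((k + 1 : ℕ) : K) := by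
  have := charZero_of_normedAlgebra_padic K p
  have h := Nat.add_one_mul_choose_eq (p ^ n - 1) k
  rw [Nat.sub_add_cancel (Nat.one_le_pow n p hp.out.pos)] at h
  rw [eq_div_iff (Nat.cast_ne_zero.mpr k.succ_ne_zero)]
  exact_mod_cast h.symm

theorem pow_prime_pow_sub_one_div_eq_tsum (a : K) (n : ℕ) :
    (a ^ p ^ n - 1) / (p : K) ^ n =
      ∑' k : ℕ, ((p ^ n - 1).choose k : K) * ((a - 1) ^ (k + 1) / ((k + 1 : ℕ) : K)) := by
  have hbinom : a ^ p ^ n - 1 =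
      ∑ k ∈ Finset.range (p ^ n), (a - 1) ^ (k + 1) * (p ^ n).choose (k + 1) := by
    nth_rw 1 [← sub_add_cancel a 1]
    rw [add_pow, Finset.sum_range_succ']
    simp
  rw [tsum_eq_sum (s := Finset.range (p ^ n)), div_eq_iff (pow_ne_zero _ (prime_ne_zero K p)),
    hbinom, Finset.sum_mul]
  · refine Finset.sum_congr rfl fun k _ => ?_
    rw [choose_prime_pow_succ_eq K p]
    ring
  · intro k hk
    have hlt : p ^ n - 1 < k := by
      have := Nat.one_le_pow n p hp.out.pos
      have := Finset.mem_range.not.mp hk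
      omega
    rw [Nat.choose_eq_zero_of_lt hlt, Nat.cast_zero, zero_mul]

variable (K) in
theorem tendsto_choose_prime_pow_sub_one (k : ℕ) :
    Tendsto (fun n : ℕ => ((p ^ n - 1).choose k : K)) atTop (𝓝 ((-1) ^ k)) := by
  induction k with
  | zero => simp
  | succ k ih =>
    have hzero : Tendsto (fun n : ℕ => ((p ^ n).choose (k + 1) : K)) atTop (𝓝 0) := by
      simp_rw [choose_prime_pow_succ_eq K p]
      simpa using ((tendsto_pow_atTop_nhds_zero_of_norm_lt_one (norm_prime_lt_one K p)).mul
        ih).div_const ((k + 1 : ℕ) : K)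
    have hsub := hzero.sub ih
    rw [zero_sub, ← neg_one_mul, ← pow_succ'] at hsub
    refine hsub.congr fun n => ?_
    have hpascal := Nat.choose_succ_succ (p ^ n - 1) k
    rw [Nat.succ_eq_add_one, Nat.sub_add_cancel (Nat.one_le_pow n p hp.out.pos)] at hpascal
    rw [hpascal, Nat.cast_add, add_sub_cancel_left]

variable [IsUltrametricDist K]

theorem norm_choose_succ_mul_pow_lt {y : K} (hy : ‖y‖ ^ (p - 1) < (p : ℝ)⁻¹) {k : ℕ}
    (hk0 : k ≠ 0) (hkp : k < p) : ‖(p.choose (k + 1) : K) * y ^ k‖ < (p : ℝ)⁻¹ := by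
  obtain rfl | hlt := (Nat.succ_le_of_lt hkp).eq_or_lt
  · simpa using hy
  · obtain ⟨c, hc⟩ := hp.out.dvd_choose_self k.succ_ne_zero hlt
    have hpos : 0 < (p : ℝ)⁻¹ := inv_pos.mpr (by exact_mod_cast hp.out.pos)
    rw [hc, Nat.cast_mul, norm_mul, norm_mul, norm_prime_eq_inv K p, norm_pow, mul_assoc]
    refine mul_lt_of_lt_one_right hpos (mul_lt_one_of_nonneg_of_lt_one_right
      (IsUltrametricDist.norm_natCast_le_one K c) (by positivity) ?_)
    exact pow_lt_one₀ (norm_nonneg y) (lt_one_of_pow_pred_lt_inv (norm_nonneg y) hy) hk0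

theorem norm_pow_prime_sub_one {a : K} (ha : ‖a - 1‖ ^ (p - 1) < (p : ℝ)⁻¹) :
    ‖a ^ p - 1‖ = (p : ℝ)⁻¹ * ‖a - 1‖ := by
  have hexpand : a ^ p - 1 =
      (∑ k ∈ Finset.range p, (p.choose (k + 1) : K) * (a - 1) ^ k) * (a - 1) := by
    nth_rw 1 [← sub_add_cancel a 1]
    rw [add_pow, Finset.sum_range_succ', Finset.sum_mul]
    simp [pow_succ, mul_comm, mul_assoc]
  have hsum : ∑ k ∈ Finset.range p, (p.choose (k + 1) : K) * (a - 1) ^ k - p =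
      ∑ k ∈ (Finset.range p).erase 0, (p.choose (k + 1) : K) * (a - 1) ^ k := by
    rw [← Finset.add_sum_erase _ _ (Finset.mem_range.mpr hp.out.pos)]
    simp
  have herase : ((Finset.range p).erase 0).Nonempty :=
    ⟨1, by simpa using hp.out.one_lt⟩
  obtain ⟨k, hk, hle⟩ := IsUltrametricDist.exists_norm_finsetSum_le_of_nonempty herase
    fun k => (p.choose (k + 1) : K) * (a - 1) ^ k
  rw [Finset.mem_erase, Finset.mem_range] at hk
  have hnorm := norm_eq_of_norm_sub_lt (y := (p : K)) (by
    rw [hsum, norm_prime_eq_inv K p]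
    exact hle.trans_lt (norm_choose_succ_mul_pow_lt p ha hk.1 hk.2))
  rw [hexpand, norm_mul, hnorm, norm_prime_eq_inv K p]

theorem norm_pow_prime_pow_sub_one {a : K} (ha : ‖a - 1‖ ^ (p - 1) < (p : ℝ)⁻¹) (n : ℕ) :
    ‖a ^ p ^ n - 1‖ = (p : ℝ)⁻¹ ^ n * ‖a - 1‖ := by
  induction n with
  | zero => simp
  | succ n ih =>
    have hp1 : (p : ℝ)⁻¹ ≤ 1 := inv_le_one_of_one_le₀ (by exact_mod_cast hp.out.one_le)
    have hle : ‖a ^ p ^ n - 1‖ ≤ ‖a - 1‖ := by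
      rw [ih]
      exact mul_le_of_le_one_left (norm_nonneg _) (pow_le_one₀ (by positivity) hp1)
    rw [pow_succ, pow_mul, norm_pow_prime_sub_one p ((by gcongr : _ ≤ _).trans_lt ha), ih]
    ring

variable [CompleteSpace K]

theorem tendsto_pow_prime_pow_sub_one_div {a : K} (ha : ‖a - 1‖ < 1) :
    Tendsto (fun n : ℕ => (a ^ p ^ n - 1) / (p : K) ^ n) atTop (𝓝 (padicLog a)) := by
  simp_rw [pow_prime_pow_sub_one_div_eq_tsum p a]
  have hsummable : Summable fun k : ℕ => ((k + 1 : ℕ) : ℝ) * ‖a - 1‖ ^ (k + 1) := by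
    have h := summable_pow_mul_geometric_of_norm_lt_one 1 (r := ‖a - 1‖) (by simpa using ha)
    simpa using (summable_nat_add_iff 1).mpr h
  refine tendsto_tsum_of_dominated_convergence hsummable (fun k => ?_)
    (Eventually.of_forall fun n k => ?_)
  · convert (tendsto_choose_prime_pow_sub_one K p k).mul_const
      ((a - 1) ^ (k + 1) / ((k + 1 : ℕ) : K)) using 2
    rw [neg_pow (a - 1), pow_succ (-1 : K) k]
    ring
  · rw [norm_mul, div_eq_mul_inv, norm_mul, norm_pow]
    calc _ ≤ 1 * (‖a - 1‖ ^ (k + 1) * ((k + 1 : ℕ) : ℝ)) := by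
          gcongr
          · exact IsUltrametricDist.norm_natCast_le_one K _
          · exact norm_natCast_inv_le K p k.succ_ne_zero
      _ = _ := by ring

theorem tendsto_pow_prime_pow_one {a : K} (ha : ‖a - 1‖ < 1) :
    Tendsto (fun n : ℕ => a ^ p ^ n) atTop (𝓝 1) := by
  have h := ((tendsto_pow_prime_pow_sub_one_div p ha).mul
    (tendsto_pow_atTop_nhds_zero_of_norm_lt_one (norm_prime_lt_one K p))).add_const 1
  rw [mul_zero, zero_add] at h
  refine h.congr fun n => ?_
  rw [div_mul_cancel₀ _ (pow_ne_zero _ (prime_ne_zero K p)), sub_add_cancel]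

theorem tendsto_pow_prime_pow_sub_pow {a z : K} (hz : ‖z‖ = 1) (h : ‖a - z‖ < 1) :
    Tendsto (fun n : ℕ => a ^ p ^ n - z ^ p ^ n) atTop (𝓝 0) := by
  have hz0 : z ≠ 0 := norm_ne_zero_iff.mp (hz ▸ one_ne_zero)
  have hquot : ‖a / z - 1‖ < 1 := by rwa [div_sub_one hz0, norm_div, hz, div_one]
  have hlim := (tendsto_pow_prime_pow_one p hquot).sub_const 1
  rw [sub_self] at hlim
  refine (hlim.zero_mul_isBoundedUnder_le (g := fun n : ℕ => z ^ p ^ n)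
    (isBoundedUnder_of ⟨1, fun n => by simp [hz]⟩)).congr fun n => ?_
  rw [sub_mul, ← mul_pow, div_mul_cancel₀ _ hz0, one_mul]

theorem norm_padicLog_eq {a : K} (ha : ‖a - 1‖ ^ (p - 1) < (p : ℝ)⁻¹) :
    ‖padicLog a‖ = ‖a - 1‖ := by
  refine tendsto_nhds_unique (tendsto_pow_prime_pow_sub_one_div p
    (lt_one_of_pow_pred_lt_inv (norm_nonneg _) ha)).norm (tendsto_const_nhds.congr fun n => ?_)
  have hp0 : (p : ℝ)⁻¹ ≠ 0 := inv_ne_zero (by exact_mod_cast hp.out.ne_zero)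
  rw [norm_div, norm_pow, norm_prime_eq_inv K p, norm_pow_prime_pow_sub_one p ha,
    mul_div_cancel_left₀ _ (pow_ne_zero _ hp0)]

theorem padicLog_pow_prime_pow {a : K} (ha : ‖a - 1‖ < 1) (m : ℕ) :
    padicLog (a ^ p ^ m) = (p : K) ^ m * padicLog a := by
  have ham : ‖a ^ p ^ m - 1‖ < 1 := by
    simpa using norm_pow_sub_pow_lt_one (norm_eq_one_of_norm_sub_one_lt_one ha).le
      norm_one.le ha (p ^ m)
  refine tendsto_nhds_unique (tendsto_pow_prime_pow_sub_one_div p ham)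
    ((((tendsto_pow_prime_pow_sub_one_div p ha).comp (tendsto_add_atTop_nat m)).const_mul _).congr
      fun n => ?_)
  have hp0 := prime_ne_zero K p
  rw [Function.comp_apply, ← pow_mul, ← pow_add, add_comm m n, pow_add (p : K)]
  field_simp

theorem padicLog_ne_zero {a : K} (ha : ‖a - 1‖ < 1) (h : ∀ n : ℕ, a ^ p ^ n ≠ 1) :
    padicLog a ≠ 0 := by
  have hlim : Tendsto (fun n : ℕ => ‖a ^ p ^ n - 1‖ ^ (p - 1)) atTop (𝓝 0) := by
    simpa [Nat.sub_ne_zero_of_lt hp.out.one_lt] using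
      ((tendsto_pow_prime_pow_one p ha).sub_const 1).norm.pow (p - 1)
  have hp0 : (0 : ℝ) < (p : ℝ)⁻¹ := inv_pos.mpr (by exact_mod_cast hp.out.pos)
  obtain ⟨m, hm⟩ := (hlim.eventually_lt_const hp0).exists
  refine right_ne_zero_of_mul (a := (p : K) ^ m) ?_
  rw [← padicLog_pow_prime_pow p ha, ← norm_ne_zero_iff, norm_padicLog_eq p hm]
  exact norm_ne_zero_iff.mpr (sub_ne_zero.mpr (h m))

end PadicLog

section LinearFactors

theorem prod_eq_prod_norm_trichotomy {K M ι : Type*} [NormedField K] [CommMonoid M] [Fintype ι]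
    (α : ι → K) (F : ι → M) :
    ∏ i, F i = (∏ i with 1 < ‖α i‖, F i) * (∏ i with ‖α i‖ < 1, F i) * ∏ i with ‖α i‖ = 1, F i := by
  simp only [Finset.prod_filter, ← Finset.prod_mul_distrib]
  refine Finset.prod_congr rfl fun i _ => ?_
  rcases lt_trichotomy ‖α i‖ 1 with h | h | h
  · simp [h, h.le, h.ne]
  · simp [h]
  · simp [h, h.le, h.ne']

theorem exists_perm_of_prod_X_sub_C_eq {R κ : Type*} [CommRing R] [IsDomain R] [Fintype κ]
    {x y : κ → R} (h : ∏ i, (X - C (x i)) = ∏ i, (X - C (y i))) :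
    ∃ σ : Equiv.Perm κ, ∀ i, y (σ i) = x i := by
  classical
  have hmultiset (z : κ → R) : (∏ i, (X - C (z i))).roots = Finset.univ.val.map z := by
    rw [← roots_multiset_prod_X_sub_C (Finset.univ.val.map z), Multiset.map_map]
    rfl
  have hroots := congrArg roots h
  rw [hmultiset, hmultiset] at hroots
  have hcard (b : R) : Fintype.card {i // x i = b} = Fintype.card {i // y i = b} := by
    have hcount := congrArg (Multiset.count b) hroots
    rw [Multiset.count_map, Multiset.count_map] at hcount
    rw [Fintype.card_subtype, Fintype.card_subtype]
    simpa [eq_comm, Finset.card_def] using hcount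
  exact ⟨Equiv.ofFiberEquiv fun b => Fintype.equivOfCardEq (hcard b),
    Equiv.ofFiberEquiv_map _⟩

theorem map_intCast_eq_prod_of_ringHom {R S ι : Type*} [CommRing R] [CommRing S] [Fintype ι]
    (φ : R →+* S) {f : ℤ[X]} {a : R} {α : ι → R}
    (hfac : f.map (Int.castRingHom R) = C a * ∏ i, (X - C (α i))) :
    f.map (Int.castRingHom S) = C (φ a) * ∏ i, (X - C (φ (α i))) := by
  rw [← RingHom.eq_intCast' (φ.comp (Int.castRingHom R)), ← Polynomial.map_map, hfac]
  simp only [Polynomial.map_mul, Polynomial.map_prod, Polynomial.map_sub, map_C, map_X]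

theorem map_intCast_eq_zero_iff_C_dvd {R : Type*} [Ring R] (p : ℕ) [CharP R p] {g : ℤ[X]} :
    g.map (Int.castRingHom R) = 0 ↔ C (p : ℤ) ∣ g := by
  rw [C_dvd_iff_dvd_coeff, Polynomial.ext_iff]
  simp [CharP.intCast_eq_zero_iff R p]

theorem frobenius_permutes_roots_of_map_intCast_eq {k κ : Type*} [Field k] (p : ℕ) [Fact p.Prime]
    [CharP k p] [Fintype κ] {g : ℤ[X]} {b : k} (hb : b ≠ 0) {m : ℕ} {x : κ → k}
    (hg : g.map (Int.castRingHom k) = C b * (X ^ m * ∏ i, (X - C (x i)))) :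
    b ^ p = b ∧ ∃ σ : Equiv.Perm κ, ∀ i, x (σ i) = x i ^ p := by
  have hmonic (y : κ → k) : (X ^ m * ∏ i, (X - C (y i))).Monic :=
    (monic_X_pow m).mul (monic_prod_of_monic _ _ fun i _ => monic_X_sub_C (y i))
  have hfrob : C (b ^ p) * (X ^ m * ∏ i, (X - C (x i ^ p))) =
      C b * (X ^ m * ∏ i, (X - C (x i))) := by
    have hfix : (g.map (Int.castRingHom k)).map (frobenius k p) = g.map (Int.castRingHom k) := by
      rw [Polynomial.map_map, RingHom.eq_intCast' ((frobenius k p).comp _)]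
    rw [hg] at hfix
    simpa only [Polynomial.map_mul, Polynomial.map_pow, Polynomial.map_prod, Polynomial.map_sub,
      map_C, map_X, frobenius_def] using hfix
  have hlead : b ^ p = b := by
    have h := congrArg leadingCoeff hfrob
    rwa [leadingCoeff_mul_monic (hmonic _), leadingCoeff_mul_monic (hmonic _), leadingCoeff_C,
      leadingCoeff_C] at h
  rw [hlead] at hfrob
  exact ⟨hlead, exists_perm_of_prod_X_sub_C_eq (mul_left_cancel₀ (pow_ne_zero m X_ne_zero)
    (mul_left_cancel₀ (C_ne_zero.mpr hb) hfrob))⟩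

end LinearFactors

section Reduction

open IsLocalRing

variable {K : Type*} [NormedField K] [IsUltrametricDist K]

variable (K) in
/-- The valuation ring `{x | ‖x‖ ≤ 1}` of an ultrametric normed field. -/
noncomputable abbrev unitBall : ValuationSubring K :=
  (NormedField.valuation (K := K)).valuationSubring

theorem residue_eq_zero_iff_norm_lt_one {x : unitBall K} :
    residue (unitBall K) x = 0 ↔ ‖(x : K)‖ < 1 := by
  have hunit : IsUnit x ↔ NormedField.valuation (x : K) = 1 :=
    (Valuation.integer.integers (NormedField.valuation (K := K))).isUnit_iff_valuation_eq_one
  have hle : ‖(x : K)‖ ≤ 1 := x.2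
  rw [residue_eq_zero_iff, mem_maximalIdeal, mem_nonunits_iff, hunit, hle.lt_iff_ne]
  exact NNReal.coe_injective.ne_iff.symm

theorem residue_eq_iff_norm_sub_lt_one {x y : unitBall K} :
    residue (unitBall K) x = residue (unitBall K) y ↔ ‖(x : K) - y‖ < 1 := by
  rw [← sub_eq_zero, ← map_sub, residue_eq_zero_iff_norm_lt_one]
  rfl

theorem norm_le_one_of_map_eq_C_mul_map {P Q : (unitBall K)[X]} {c : K}
    (hQ : Q.map (residue (unitBall K)) ≠ 0)
    (h : P.map (unitBall K).subtype = C c * Q.map (unitBall K).subtype) : ‖c‖ ≤ 1 := by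
  obtain ⟨n, hn⟩ : ∃ n, (Q.map (residue (unitBall K))).coeff n ≠ 0 := by
    by_contra! hzero
    exact hQ (Polynomial.ext hzero)
  have hQn : 1 ≤ ‖(Q.coeff n : K)‖ := by
    rwa [coeff_map, Ne, residue_eq_zero_iff_norm_lt_one, not_lt] at hn
  have hcoeff : (P.coeff n : K) = c * Q.coeff n := by
    simpa using congrArg (coeff · n) h
  calc ‖c‖ ≤ ‖c‖ * ‖(Q.coeff n : K)‖ := le_mul_of_one_le_right (norm_nonneg c) hQn
    _ = ‖(P.coeff n : K)‖ := by rw [hcoeff, norm_mul]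
    _ ≤ 1 := (P.coeff n).2

theorem norm_eq_one_of_map_eq_C_mul_map {P Q : (unitBall K)[X]} {c : K}
    (hP : P.map (residue (unitBall K)) ≠ 0) (hQ : Q.map (residue (unitBall K)) ≠ 0)
    (h : P.map (unitBall K).subtype = C c * Q.map (unitBall K).subtype) : ‖c‖ = 1 := by
  have hc0 : c ≠ 0 := by
    rintro rfl
    rw [C_0, zero_mul, Polynomial.map_eq_zero_iff Subtype.val_injective] at h
    exact hP (by rw [h, Polynomial.map_zero])
  have hinv : Q.map (unitBall K).subtype = C c⁻¹ * P.map (unitBall K).subtype := by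
    rw [h, ← mul_assoc, ← C_mul, inv_mul_cancel₀ hc0, C_1, one_mul]
  refine (norm_le_one_of_map_eq_C_mul_map hQ h).antisymm ?_
  have hle := norm_le_one_of_map_eq_C_mul_map hP hinv
  rwa [norm_inv, inv_le_one₀ (norm_pos_iff.mpr hc0)] at hle

/-- The multiple of `X - a` with integral coefficients and nonzero reduction: `X - a` for integral
`a`, and `a⁻¹ X - 1` otherwise. -/
noncomputable def primitiveLinearFactor (a : K) : (unitBall K)[X] :=
  if h : ‖a‖ ≤ 1 then X - C ⟨a, h⟩
  else C ⟨a⁻¹, (norm_inv a).trans_le (inv_le_one_of_one_le₀ (not_le.mp h).le)⟩ * X - 1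

theorem X_sub_C_eq_C_mul_map_primitiveLinearFactor (a : K) :
    X - C a = C (if 1 < ‖a‖ then a else 1) *
      (primitiveLinearFactor a).map (unitBall K).subtype := by
  unfold primitiveLinearFactor
  by_cases h : 1 < ‖a‖
  · have ha : a ≠ 0 := norm_pos_iff.mp (one_pos.trans h)
    rw [dif_neg h.not_ge, if_pos h]
    simp only [Polynomial.map_sub, Polynomial.map_mul, map_C, map_X, Polynomial.map_one,
      ValuationSubring.subtype_apply]
    rw [mul_sub, ← mul_assoc, ← C_mul, mul_inv_cancel₀ ha, C_1, one_mul, mul_one]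
  · rw [dif_pos (not_lt.mp h), if_neg h]
    simp

theorem map_residue_primitiveLinearFactor_of_one_lt_norm {a : K} (h : 1 < ‖a‖) :
    (primitiveLinearFactor a).map (residue (unitBall K)) = -1 := by
  have hres : residue (unitBall K)
      ⟨a⁻¹, (norm_inv a).trans_le (inv_le_one_of_one_le₀ h.le)⟩ = 0 :=
    residue_eq_zero_iff_norm_lt_one.mpr ((norm_inv a).trans_lt (inv_lt_one_of_one_lt₀ h))
  rw [primitiveLinearFactor, dif_neg h.not_ge]
  simp [hres]

theorem map_residue_primitiveLinearFactor_of_norm_le_one {a : K} (h : ‖a‖ ≤ 1) :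
    (primitiveLinearFactor a).map (residue (unitBall K)) =
      X - C (residue (unitBall K) ⟨a, h⟩) := by
  rw [primitiveLinearFactor, dif_pos h]
  simp

variable {ι : Type*} [Fintype ι]

/-- For `b ∏ (t - α i)`, the product of the leading coefficient `b` with the roots outside the unit
ball: the unit by which the polynomial differs from the product of its primitive linear factors. -/
noncomputable def unitLeadingCoeff {K : Type*} [NormedField K] (b : K) (α : ι → K) : K :=
  b * ∏ i with 1 < ‖α i‖, α i

theorem C_mul_prod_X_sub_C_eq (b : K) (α : ι → K) :
    C b * ∏ i, (X - C (α i)) = C (unitLeadingCoeff b α) *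
      (∏ i, primitiveLinearFactor (α i)).map (unitBall K).subtype := by
  simp_rw [X_sub_C_eq_C_mul_map_primitiveLinearFactor]
  rw [Finset.prod_mul_distrib, unitLeadingCoeff, Finset.prod_filter, C_mul, map_prod,
    Polynomial.map_prod, mul_assoc]

theorem map_residue_prod_primitiveLinearFactor (α : ι → K) :
    (∏ i, primitiveLinearFactor (α i)).map (residue (unitBall K)) =
      C ((-1) ^ Finset.card {i | 1 < ‖α i‖}) * (X ^ Finset.card {i | ‖α i‖ < 1} *
        ∏ i : {i // ‖α i‖ = 1}, (X - C (residue (unitBall K) ⟨α i, i.2.le⟩))) := by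
  rw [Polynomial.map_prod, prod_eq_prod_norm_trichotomy α, mul_assoc]
  congr 1
  · rw [Finset.prod_congr rfl fun i hi =>
      map_residue_primitiveLinearFactor_of_one_lt_norm (Finset.mem_filter.mp hi).2]
    simp
  congr 1
  · rw [← Finset.prod_const]
    refine Finset.prod_congr rfl fun i hi => ?_
    have hlt := (Finset.mem_filter.mp hi).2
    rw [map_residue_primitiveLinearFactor_of_norm_le_one hlt.le,
      residue_eq_zero_iff_norm_lt_one.mpr hlt, C_0, sub_zero]
  · rw [Finset.prod_subtype _ (p := fun i => ‖α i‖ = 1) (by simp)]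
    exact Finset.prod_congr rfl fun i _ =>
      map_residue_primitiveLinearFactor_of_norm_le_one i.2.le

variable (p : ℕ) [hp : Fact p.Prime] [NormedAlgebra ℚ_[p] K]

variable (K) in
theorem charP_residueField_unitBall : CharP (ResidueField (unitBall K)) p := by
  refine (CharP.charP_iff_prime_eq_zero hp.out).mpr ?_
  rw [← map_natCast (residue (unitBall K)), residue_eq_zero_iff_norm_lt_one]
  exact norm_prime_lt_one K p

variable {g : ℤ[X]} {b : K} {α : ι → K}

theorem norm_unitLeadingCoeff_eq_one (hg : ¬ C (p : ℤ) ∣ g)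
    (hfac : g.map (Int.castRingHom K) = C b * ∏ i, (X - C (α i))) :
    ‖unitLeadingCoeff b α‖ = 1 := by
  have := charP_residueField_unitBall K p
  refine norm_eq_one_of_map_eq_C_mul_map (P := g.map (Int.castRingHom (unitBall K)))
    (Q := ∏ i, primitiveLinearFactor (α i)) ?_ ?_ ?_
  · rwa [Polynomial.map_map, RingHom.eq_intCast' ((residue (unitBall K)).comp _), Ne,
      map_intCast_eq_zero_iff_C_dvd p]
  · rw [map_residue_prod_primitiveLinearFactor]
    exact mul_ne_zero (C_ne_zero.mpr (pow_ne_zero _ (neg_ne_zero.mpr one_ne_zero)))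
      (mul_ne_zero (pow_ne_zero _ X_ne_zero)
        (Finset.prod_ne_zero_iff.mpr fun _ _ => X_sub_C_ne_zero _))
  · rw [Polynomial.map_map, RingHom.eq_intCast' ((unitBall K).subtype.comp _), hfac,
      C_mul_prod_X_sub_C_eq]

theorem map_intCast_residueField_eq (hc : ‖unitLeadingCoeff b α‖ ≤ 1)
    (hfac : g.map (Int.castRingHom K) = C b * ∏ i, (X - C (α i))) :
    g.map (Int.castRingHom (ResidueField (unitBall K))) =
      C (residue (unitBall K) ⟨unitLeadingCoeff b α, hc⟩ * (-1) ^ Finset.card {i | 1 < ‖α i‖}) *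
        (X ^ Finset.card {i | ‖α i‖ < 1} *
          ∏ i : {i // ‖α i‖ = 1}, (X - C (residue (unitBall K) ⟨α i, i.2.le⟩))) := by
  have hball : g.map (Int.castRingHom (unitBall K)) =
      C ⟨unitLeadingCoeff b α, hc⟩ * ∏ i, primitiveLinearFactor (α i) := by
    refine Polynomial.map_injective (unitBall K).subtype Subtype.val_injective ?_
    rw [Polynomial.map_map, RingHom.eq_intCast' ((unitBall K).subtype.comp _), hfac,
      C_mul_prod_X_sub_C_eq, Polynomial.map_mul, map_C]
    rfl
  rw [← RingHom.eq_intCast' ((residue (unitBall K)).comp (Int.castRingHom (unitBall K))),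
    ← Polynomial.map_map, hball, Polynomial.map_mul, map_C,
    map_residue_prod_primitiveLinearFactor, ← mul_assoc, ← C_mul]

theorem frobenius_unitLeadingCoeff_and_unit_roots (hg : ¬ C (p : ℤ) ∣ g)
    (hfac : g.map (Int.castRingHom K) = C b * ∏ i, (X - C (α i))) :
    ‖unitLeadingCoeff b α ^ p - unitLeadingCoeff b α‖ < 1 ∧
      ∃ σ : Equiv.Perm {i // ‖α i‖ = 1}, ∀ i, ‖α (σ i) - α i ^ p‖ < 1 := by
  have := charP_residueField_unitBall K p
  have hc := norm_unitLeadingCoeff_eq_one p hg hfac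
  have hsign : (-1 : ResidueField (unitBall K)) ^ Finset.card {i | 1 < ‖α i‖} ≠ 0 :=
    pow_ne_zero _ (neg_ne_zero.mpr one_ne_zero)
  have hres : residue (unitBall K) ⟨unitLeadingCoeff b α, hc.le⟩ ≠ 0 := by
    rw [Ne, residue_eq_zero_iff_norm_lt_one, hc]
    exact lt_irrefl 1
  obtain ⟨hlead, σ, hσ⟩ := frobenius_permutes_roots_of_map_intCast_eq p (mul_ne_zero hres hsign)
    (map_intCast_residueField_eq hc.le hfac)
  constructor
  · rw [← frobenius_def, map_mul, map_pow, map_neg, map_one, mul_left_inj' hsign, frobenius_def,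
      ← map_pow] at hlead
    exact residue_eq_iff_norm_sub_lt_one.mp hlead
  · refine ⟨σ, fun i => ?_⟩
    have hi := hσ i
    rw [← map_pow] at hi
    exact residue_eq_iff_norm_sub_lt_one.mp hi

end Reduction

section Teichmuller

theorem exists_pow_eq_one_norm_sub_lt_one {K : Type*} [NormedField K] [IsAlgClosed K] {a : K}
    {m : ℕ} (hm : m ≠ 0) (h : ‖a ^ m - 1‖ < 1) : ∃ z, z ^ m = 1 ∧ ‖a - z‖ < 1 := by
  have hmonic : (X ^ m - 1 : K[X]).Monic := by simpa using monic_X_pow_sub_C (1 : K) hm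
  have heval := (IsAlgClosed.splits (X ^ m - 1 : K[X])).eval_eq_prod_roots_of_monic hmonic a
  rw [eval_sub, eval_pow, eval_X, eval_one] at heval
  by_contra! hfar
  refine h.not_ge ?_
  rw [heval, ← normHom_apply, map_multiset_prod, Multiset.map_map]
  refine Multiset.one_le_prod_map fun z hz => hfar z ?_
  simpa [sub_eq_zero] using (mem_roots'.mp hz).2

theorem eq_one_of_pow_eq_one_of_norm_sub_one_lt_one {K : Type*} [NormedField K]
    [IsUltrametricDist K] (p : ℕ) [Fact p.Prime] [NormedAlgebra ℚ_[p] K] {z : K} {m : ℕ}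
    (hm : m.Coprime p) (hz : z ^ m = 1) (h : ‖z - 1‖ < 1) : z = 1 := by
  have hm1 : ‖(m : K)‖ = 1 := by
    rw [norm_natCast_eq_padicNorm K p, Padic.norm_natCast_eq_one_iff]
    exact hm.symm
  have hsum : ∑ i ∈ Finset.range m, z ^ i ≠ 0 := by
    intro hzero
    have hm_eq : (m : K) = ∑ i ∈ Finset.range m, (1 - z ^ i) := by
      rw [Finset.sum_sub_distrib, hzero]
      simp
    obtain ⟨i, -, hi⟩ := IsUltrametricDist.exists_norm_finsetSum_le (Finset.range m)
      fun i => 1 - z ^ i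
    rw [← hm_eq, hm1, norm_sub_rev] at hi
    refine hi.not_gt ?_
    simpa using norm_pow_sub_pow_lt_one (norm_eq_one_of_norm_sub_one_lt_one h).le norm_one.le h i
  have hgeom := geom_sum_mul z m
  rw [hz, sub_self] at hgeom
  exact sub_eq_zero.mp ((mul_eq_zero.mp hgeom).resolve_left hsum)

variable {p : ℕ} [hp : Fact p.Prime] {a b z w : ℂ_[p]}

theorem IsTeichmullerRep.norm_eq_one (h : IsTeichmullerRep p a z) : ‖z‖ = 1 :=
  h.1.norm_eq_one

theorem IsTeichmullerRep.norm_left_eq_one (h : IsTeichmullerRep p a z) : ‖a‖ = 1 := by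
  rw [← h.norm_eq_one]
  exact norm_eq_of_norm_sub_lt (h.2.2.trans_eq h.norm_eq_one.symm)

theorem IsTeichmullerRep.ne_zero (h : IsTeichmullerRep p a z) : z ≠ 0 :=
  norm_ne_zero_iff.mp (h.norm_eq_one ▸ one_ne_zero)

theorem IsTeichmullerRep.eq (hz : IsTeichmullerRep p a z) (hw : IsTeichmullerRep p a w) :
    z = w := by
  rw [← div_eq_one_iff_eq hw.ne_zero]
  refine eq_one_of_pow_eq_one_of_norm_sub_one_lt_one p (Nat.Coprime.mul_left hz.2.1 hw.2.1) ?_ ?_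
  · rw [div_pow, pow_mul, pow_orderOf_eq_one, one_pow, mul_comm, pow_mul, pow_orderOf_eq_one,
      one_pow, div_one]
  · rw [div_sub_one hw.ne_zero, norm_div, hw.norm_eq_one, div_one]
    exact norm_sub_lt_one_trans (norm_sub_rev z a ▸ hz.2.2) hw.2.2

theorem IsTeichmullerRep.congr (h : IsTeichmullerRep p a z) (hab : ‖b - a‖ < 1) :
    IsTeichmullerRep p b z :=
  ⟨h.1, h.2.1, norm_sub_lt_one_trans hab h.2.2⟩

theorem IsTeichmullerRep.pow (h : IsTeichmullerRep p a z) (n : ℕ) :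
    IsTeichmullerRep p (a ^ n) (z ^ n) :=
  ⟨h.1.pow, h.2.1.coprime_dvd_left (orderOf_pow_dvd n),
    norm_pow_sub_pow_lt_one h.norm_left_eq_one.le h.norm_eq_one.le h.2.2 n⟩

theorem isTeichmullerRep_one_iff : IsTeichmullerRep p a 1 ↔ ‖a - 1‖ < 1 := by
  simp [IsTeichmullerRep, IsOfFinOrder.one]

theorem IsTeichmullerRep.eq_one_iff (h : IsTeichmullerRep p a z) : z = 1 ↔ ‖a - 1‖ < 1 :=
  Iff.trans ⟨fun hz => hz ▸ h, h.eq⟩ isTeichmullerRep_one_iff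

theorem IsTeichmullerRep.norm_sub_one_eq_one_iff (h : IsTeichmullerRep p a z) :
    ‖a - 1‖ = 1 ↔ z ≠ 1 := by
  rw [Ne, h.eq_one_iff, not_lt, (norm_sub_one_le_one h.norm_left_eq_one.le).ge_iff_eq]

theorem IsTeichmullerRep.self (h : IsTeichmullerRep p a z) : IsTeichmullerRep p z z :=
  ⟨h.1, h.2.1, by simp⟩

theorem IsTeichmullerRep.pow_prime_pow_eq_one_iff (h : IsTeichmullerRep p a z) (n : ℕ) :
    z ^ p ^ n = 1 ↔ z = 1 := by
  refine ⟨fun hz => ?_, fun hz => by simp [hz]⟩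
  exact orderOf_eq_one_iff.mp
    (Nat.Coprime.eq_one_of_dvd (h.2.1.pow_right n) (orderOf_dvd_of_pow_eq_one hz))

theorem IsTeichmullerRep.tendsto_pow_prime_pow (h : IsTeichmullerRep p a z) (hz : z ^ p = z) :
    Tendsto (fun n : ℕ => a ^ p ^ n) atTop (𝓝 z) := by
  have hfix (n : ℕ) : z ^ p ^ n = z := by
    induction n with
    | zero => simp
    | succ n ih => rw [pow_succ, pow_mul, ih, hz]
  have hlim := (tendsto_pow_prime_pow_sub_pow p h.norm_eq_one h.2.2).add_const z
  simpa only [hfix, sub_add_cancel, zero_add] using hlim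

theorem existsUnique_isTeichmullerRep {k : ℕ} (hk : k ≠ 0) (ha : ‖a‖ = 1)
    (h : ‖a ^ p ^ k - a‖ < 1) : ∃! z, IsTeichmullerRep p a z := by
  obtain ⟨m, hm⟩ : ∃ m, p ^ k = m + 1 :=
    Nat.exists_eq_succ_of_ne_zero (pow_ne_zero k hp.out.ne_zero)
  have hm0 : m ≠ 0 := by
    have := Nat.one_lt_pow hk hp.out.one_lt
    omega
  have ham : ‖a ^ m - 1‖ < 1 := by
    rwa [hm, pow_succ, ← sub_one_mul, norm_mul, ha, mul_one] at h
  obtain ⟨z, hzm, hza⟩ := exists_pow_eq_one_norm_sub_lt_one hm0 ham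
  have hcoprime : m.Coprime p := by
    refine Nat.Coprime.coprime_dvd_right (dvd_pow_self p hk) ?_
    rw [hm]
    exact Nat.coprime_self_add_right.mpr (Nat.coprime_one_right m)
  have hz : IsTeichmullerRep p a z :=
    ⟨isOfFinOrder_iff_pow_eq_one.mpr ⟨m, Nat.pos_of_ne_zero hm0, hzm⟩,
      hcoprime.coprime_dvd_left (orderOf_dvd_of_pow_eq_one hzm), hza⟩
  exact ⟨z, hz, fun w hw => hw.eq hz⟩

section Roots

variable {ι : Type*} {α : ι → ℂ_[p]} {σ : Equiv.Perm {i // ‖α i‖ = 1}}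

theorem norm_perm_pow_sub_pow_prime_pow_lt_one (hσ : ∀ i, ‖α (σ i) - α i ^ p‖ < 1) (k : ℕ)
    (i : {i // ‖α i‖ = 1}) : ‖α ((σ ^ k) i) - α i ^ p ^ k‖ < 1 := by
  induction k with
  | zero => simp
  | succ k ih =>
    rw [pow_succ' σ, pow_succ p, pow_mul (α i)]
    refine norm_sub_lt_one_trans (hσ ((σ ^ k) i)) (norm_pow_sub_pow_lt_one ?_ ?_ ih p)
    · exact ((σ ^ k) i).2.le
    · simp [i.2]

theorem existsUnique_isTeichmullerRep_of_perm [Finite ι] (hσ : ∀ i, ‖α (σ i) - α i ^ p‖ < 1)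
    (i : ι) (hi : ‖α i‖ = 1) : ∃! z, IsTeichmullerRep p (α i) z := by
  refine existsUnique_isTeichmullerRep (orderOf_pos σ).ne' hi ?_
  have h := norm_perm_pow_sub_pow_prime_pow_lt_one hσ (orderOf σ) ⟨i, hi⟩
  rwa [pow_orderOf_eq_one, Equiv.Perm.one_apply, norm_sub_rev] at h

theorem teichmullerRep_perm_eq_pow {ζ : ι → ℂ_[p]} (hσ : ∀ i, ‖α (σ i) - α i ^ p‖ < 1)
    (hζ : ∀ i, ‖α i‖ = 1 → IsTeichmullerRep p (α i) (ζ i)) (i : {i // ‖α i‖ = 1}) :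
    ζ (σ i) = ζ i ^ p :=
  (hζ _ (σ i).2).eq (((hζ i i.2).pow p).congr (hσ i))

end Roots

end Teichmuller

section CyclicResultant

theorem cyclicResultant_C_mul {a : ℤ} (ha : a ≠ 0) (n : ℕ) (f : ℤ[X]) :
    cyclicResultant n (C a * f) = a ^ n * cyclicResultant n f := by
  have hdeg : (X ^ n - 1 : ℤ[X]).natDegree = n := natDegree_X_pow_sub_C (r := (1 : ℤ))
  rw [cyclicResultant, cyclicResultant, natDegree_C_mul ha, resultant_C_mul_right, hdeg]

theorem cyclicResultant_eq_prod {K ι : Type*} [Field K] [CharZero K] [Fintype ι] {f : ℤ[X]}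
    (hf : f ≠ 0) {a : K} {α : ι → K}
    (hfac : f.map (Int.castRingHom K) = C a * ∏ i, (X - C (α i))) (n : ℕ) :
    (cyclicResultant n f : K) = (-1) ^ (n * f.natDegree) * (a ^ n * ∏ i, (α i ^ n - 1)) := by
  have hinj : Function.Injective (Int.castRingHom K) := Int.cast_injective
  have ha : a ≠ 0 := by
    rintro rfl
    rw [C_0, zero_mul, Polynomial.map_eq_zero_iff hinj] at hfac
    exact hf hfac
  have hprod : (∏ i, (X - C (α i))).natDegree = Fintype.card ι := by
    simp [natDegree_prod_of_monic _ _ fun i _ => monic_X_sub_C (α i)]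
  have hf_deg : f.natDegree = Fintype.card ι := by
    rw [← natDegree_map_eq_of_injective hinj, hfac, natDegree_C_mul ha, hprod]
  have hX_int : (X ^ n - 1 : ℤ[X]).natDegree = n := natDegree_X_pow_sub_C (r := (1 : ℤ))
  have hX : (X ^ n - 1 : K[X]).natDegree = n := natDegree_X_pow_sub_C (r := (1 : K))
  have hlinear (i : ι) : (X ^ n - 1 : K[X]).resultant (X - C (α i)) n (X - C (α i)).natDegree =
      (-1) ^ n * (α i ^ n - 1) := by
    rw [natDegree_X_sub_C, resultant_X_sub_C_right _ _ _ hX.le, eval_sub, eval_pow, eval_X,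
      eval_one]
  calc (cyclicResultant n f : K)
      = a ^ n * (X ^ n - 1 : K[X]).resultant (∏ i, (X - C (α i))) n
          (∏ i, (X - C (α i))).natDegree := by
        rw [cyclicResultant, ← eq_intCast (Int.castRingHom K), ← resultant_map_map, hfac, hX_int,
          resultant_C_mul_right, hf_deg, hprod, Polynomial.map_sub, Polynomial.map_pow, map_X,
          Polynomial.map_one]
    _ = a ^ n * ∏ i, (-1) ^ n * (α i ^ n - 1) := by
        rw [resultant_prod_right _ _ _ _ hX.le (by simp),
          Finset.prod_congr rfl fun i _ => hlinear i]
    _ = (-1) ^ (n * f.natDegree) * (a ^ n * ∏ i, (α i ^ n - 1)) := by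
        rw [Finset.prod_mul_distrib, Finset.prod_const, Finset.card_univ, hf_deg, ← pow_mul]
        ring

variable {p : ℕ} [hp : Fact p.Prime]

theorem cyclicResultant_C_prime_pow_mul (μ n : ℕ) (g : ℤ[X]) :
    cyclicResultant n (C (p : ℤ) ^ μ * g) = (p : ℤ) ^ (μ * n) * cyclicResultant n g := by
  have hp0 : (p : ℤ) ^ μ ≠ 0 := pow_ne_zero μ (by exact_mod_cast hp.out.ne_zero)
  rw [← C_pow, cyclicResultant_C_mul hp0, pow_mul]

theorem tendsto_cyclicResultant_zero_of_dvd {f : ℤ[X]} (h : C (p : ℤ) ∣ f) :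
    Tendsto (fun n : ℕ => (cyclicResultant (p ^ n) f : ℤ_[p])) atTop (𝓝 0) := by
  obtain ⟨g, rfl⟩ := h
  have hpow : Tendsto (fun n : ℕ => (p : ℤ_[p]) ^ p ^ n) atTop (𝓝 0) :=
    (tendsto_pow_atTop_nhds_zero_of_norm_lt_one
      (PadicInt.norm_natCast_lt_one_iff.mpr dvd_rfl)).comp
      (tendsto_pow_atTop_atTop_of_one_lt hp.out.one_lt)
  refine (hpow.zero_mul_isBoundedUnder_le
    (g := fun n : ℕ => (cyclicResultant (p ^ n) g : ℤ_[p]))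
    (isBoundedUnder_of ⟨1, fun n => PadicInt.norm_le_one _⟩)).congr fun n => ?_
  rw [cyclicResultant_C_mul (by exact_mod_cast hp.out.ne_zero)]
  push_cast
  rfl

theorem nonPPart_prime_pow_mul (k : ℕ) (x : ℤ) :
    nonPPart p ((p : ℤ) ^ k * x) = nonPPart p x := by
  obtain rfl | hx := eq_or_ne x 0
  · simp
  have hp0 : (p : ℤ) ^ k ≠ 0 := pow_ne_zero k (by exact_mod_cast hp.out.ne_zero)
  have hval : padicValInt p ((p : ℤ) ^ k * x) = k + padicValInt p x := by
    rw [padicValInt.mul hp0 hx, ← Nat.cast_pow, padicValInt.of_nat, padicValNat.prime_pow]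
  rw [nonPPart, hval, pow_add, Int.mul_ediv_mul_of_pos _ _ (by positivity), nonPPart]

theorem IsIwasawaInvariants.prime_pow_mul {g : ℤ[X]} {lam : ℕ} {ν : ℤ}
    (h : IsIwasawaInvariants p g lam 0 ν) (μ : ℕ) :
    IsIwasawaInvariants p (C (p : ℤ) ^ μ * g) lam μ ν := by
  refine h.mono fun n hn => ?_
  have hp0 : (p : ℝ) ≠ 0 := by exact_mod_cast hp.out.ne_zero
  rw [cyclicResultant_C_prime_pow_mul, Int.cast_mul, Int.cast_pow, Int.cast_natCast, norm_mul,
    mul_inv, hn, norm_pow, Padic.norm_p, inv_pow, inv_inv, ← zpow_natCast, ← zpow_add₀ hp0]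
  congr 1
  push_cast
  ring

theorem natDegree_C_prime_pow_mul (μ : ℕ) (g : ℤ[X]) :
    (C (p : ℤ) ^ μ * g).natDegree = g.natDegree := by
  rw [← C_pow]
  exact natDegree_C_mul (pow_ne_zero μ (by exact_mod_cast hp.out.ne_zero))

theorem prime_zpow_neg_mul_eval_one (μ : ℕ) (g : ℤ[X]) :
    (p : ℚ_[p]) ^ (-(μ : ℤ)) * ((C (p : ℤ) ^ μ * g).eval 1 : ℤ) = (g.eval 1 : ℤ) := by
  have hp0 : (p : ℚ_[p]) ^ μ ≠ 0 := pow_ne_zero μ (by exact_mod_cast hp.out.ne_zero)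
  rw [eval_mul, eval_pow, eval_C, zpow_neg, zpow_natCast]
  push_cast
  rw [inv_mul_cancel_left₀ hp0]

theorem map_intCast_eq_of_map_prime_pow_mul_eq {K : Type*} [Field K] [CharZero K] {μ : ℕ}
    {g : ℤ[X]} {a : K} {q : K[X]}
    (h : (C (p : ℤ) ^ μ * g).map (Int.castRingHom K) = C a * q) :
    g.map (Int.castRingHom K) = C ((p : K) ^ (-(μ : ℤ)) * a) * q := by
  have hp0 : (p : K) ^ μ ≠ 0 := pow_ne_zero μ (by exact_mod_cast hp.out.ne_zero)
  rw [C_mul, mul_assoc, ← h, Polynomial.map_mul, Polynomial.map_pow, map_C, eq_intCast,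
    Int.cast_natCast, ← mul_assoc, ← C_pow, ← C_mul, zpow_neg, zpow_natCast,
    inv_mul_cancel₀ hp0, C_1, one_mul]

end CyclicResultant

section IntegerSequences

variable {p : ℕ} [hp : Fact p.Prime]

theorem exists_padicInt_tendsto {z : ℕ → ℤ} {l : ℂ_[p]}
    (h : Tendsto (fun n => (z n : ℂ_[p])) atTop (𝓝 l)) :
    ∃ L : ℤ_[p], Tendsto (fun n => (z n : ℤ_[p])) atTop (𝓝 L) ∧
      algebraMap ℚ_[p] ℂ_[p] (L : ℚ_[p]) = l := by
  have hiso : Isometry fun x : ℤ_[p] => algebraMap ℚ_[p] ℂ_[p] (x : ℚ_[p]) :=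
    (algebraMap_isometry ℚ_[p] ℂ_[p]).comp isometry_subtype_coe
  have hemb := hiso.isClosedEmbedding
  have hcast (n : ℕ) : algebraMap ℚ_[p] ℂ_[p] ((z n : ℤ_[p]) : ℚ_[p]) = z n := by
    rw [PadicInt.coe_intCast, map_intCast]
  obtain ⟨L, rfl⟩ := hemb.isClosed_range.mem_of_tendsto h
    (Eventually.of_forall fun n => ⟨(z n : ℤ_[p]), hcast n⟩)
  exact ⟨L, hemb.isInducing.tendsto_nhds_iff.mpr (h.congr fun n => (hcast n).symm), rfl⟩

theorem norm_intCast_eq_zpow_neg_padicValInt {x : ℤ} (hx : x ≠ 0) :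
    ‖(x : ℂ_[p])‖ = (p : ℝ) ^ (-(padicValInt p x : ℤ)) := by
  rw [norm_intCast_eq_padicNorm ℂ_[p] p, Padic.norm_eq_zpow_neg_valuation (by exact_mod_cast hx),
    Padic.valuation_intCast]

theorem nonPPart_cast_eq_mul_zpow {x e : ℤ} (he : ‖(x : ℂ_[p])‖ = (p : ℝ) ^ (-e)) :
    (nonPPart p x : ℂ_[p]) = x * (p : ℂ_[p]) ^ (-e) := by
  have hp1 : (1 : ℝ) < p := by exact_mod_cast hp.out.one_lt
  have hx : x ≠ 0 := by
    rintro rfl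
    rw [Int.cast_zero, norm_zero] at he
    exact (zpow_ne_zero _ (by positivity)) he.symm
  rw [norm_intCast_eq_zpow_neg_padicValInt hx] at he
  rw [← zpow_right_injective₀ (by positivity) hp1.ne' he]
  have hp0 : (((p : ℤ) ^ padicValInt p x : ℤ) : ℂ_[p]) ≠ 0 := by
    exact_mod_cast pow_ne_zero _ (prime_ne_zero ℂ_[p] p)
  rw [nonPPart, Int.cast_div (padicValInt_dvd x) hp0, zpow_neg, zpow_natCast, div_eq_mul_inv]
  push_cast
  rfl

variable {z : ℕ → ℤ} {lam : ℕ} {v : ℂ_[p]} {ν : ℤ}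

theorem eventually_norm_intCast_eq (hv : v ≠ 0)
    (h : Tendsto (fun n => (z n : ℂ_[p]) / (p : ℂ_[p]) ^ (n * lam)) atTop (𝓝 v)) :
    ∀ᶠ n in atTop, ‖(z n : ℂ_[p])‖ = (p : ℝ) ^ (-((lam : ℤ) * n)) * ‖v‖ := by
  filter_upwards [eventually_norm_eq_of_tendsto h hv] with n hn
  have hp0 : (p : ℝ) ≠ 0 := by exact_mod_cast hp.out.ne_zero
  rw [← hn, norm_div, norm_pow, norm_prime_eq_inv ℂ_[p] p, zpow_neg, mul_comm (lam : ℤ),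
    ← Nat.cast_mul, zpow_natCast, inv_pow, div_inv_eq_mul, mul_comm ‖_‖,
    inv_mul_cancel_left₀ (pow_ne_zero _ hp0)]

theorem exists_norm_eq_prime_zpow (hv : v ≠ 0)
    (h : Tendsto (fun n => (z n : ℂ_[p]) / (p : ℂ_[p]) ^ (n * lam)) atTop (𝓝 v)) :
    ∃ ν : ℤ, ‖v‖ = (p : ℝ) ^ (-ν) := by
  have hp0 : (p : ℝ) ≠ 0 := by exact_mod_cast hp.out.ne_zero
  obtain ⟨n, hn⟩ := (eventually_norm_intCast_eq hv h).exists
  have hz : z n ≠ 0 := by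
    intro hzero
    rw [hzero, Int.cast_zero, norm_zero, eq_comm, mul_eq_zero] at hn
    exact hn.elim (zpow_ne_zero _ hp0) (norm_ne_zero_iff.mpr hv)
  refine ⟨padicValInt p (z n) - lam * n, ?_⟩
  rw [norm_intCast_eq_zpow_neg_padicValInt hz, zpow_neg _ ((lam : ℤ) * n), eq_inv_mul_iff_mul_eq₀
    (zpow_ne_zero _ hp0), ← zpow_add₀ hp0] at hn
  rw [← hn]
  ring_nf

theorem eventually_norm_intCast_eq_zpow (hν : ‖v‖ = (p : ℝ) ^ (-ν))
    (h : Tendsto (fun n => (z n : ℂ_[p]) / (p : ℂ_[p]) ^ (n * lam)) atTop (𝓝 v)) :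
    ∀ᶠ n in atTop, ‖(z n : ℂ_[p])‖ = (p : ℝ) ^ (-((lam : ℤ) * n + ν)) := by
  have hp0 : (p : ℝ) ≠ 0 := by exact_mod_cast hp.out.ne_zero
  have hv : v ≠ 0 := norm_ne_zero_iff.mp (hν ▸ zpow_ne_zero _ hp0)
  filter_upwards [eventually_norm_intCast_eq hv h] with n hn
  rw [hn, hν, ← zpow_add₀ hp0, neg_add]

theorem tendsto_nonPPart (hν : ‖v‖ = (p : ℝ) ^ (-ν))
    (h : Tendsto (fun n => (z n : ℂ_[p]) / (p : ℂ_[p]) ^ (n * lam)) atTop (𝓝 v)) :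
    Tendsto (fun n => (nonPPart p (z n) : ℂ_[p])) atTop (𝓝 (v * (p : ℂ_[p]) ^ (-ν))) := by
  refine (h.mul_const _).congr' ?_
  filter_upwards [eventually_norm_intCast_eq_zpow hν h] with n hn
  rw [nonPPart_cast_eq_mul_zpow hn, neg_add, zpow_add₀ (prime_ne_zero ℂ_[p] p), zpow_neg _ (_ * _),
    mul_comm (lam : ℤ), div_eq_mul_inv, mul_assoc]
  norm_cast

end IntegerSequences

section RootProducts

variable {K : Type*} [NormedField K] {ι : Type*} [Fintype ι]

theorem pow_mul_prod_pow_sub_one (b : K) (α : ι → K) (n : ℕ) :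
    b ^ n * ∏ i, (α i ^ n - 1) =
      unitLeadingCoeff b α ^ n * (∏ i with 1 < ‖α i‖, (1 - (α i)⁻¹ ^ n)) *
        (∏ i with ‖α i‖ < 1, (α i ^ n - 1)) * ∏ i with ‖α i‖ = 1, (α i ^ n - 1) := by
  have hlarge : ∏ i with 1 < ‖α i‖, (α i ^ n - 1) =
      (∏ i with 1 < ‖α i‖, α i) ^ n * ∏ i with 1 < ‖α i‖, (1 - (α i)⁻¹ ^ n) := by
    rw [← Finset.prod_pow, ← Finset.prod_mul_distrib]
    refine Finset.prod_congr rfl fun i hi => ?_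
    have hne : α i ≠ 0 := norm_pos_iff.mp (one_pos.trans (Finset.mem_filter.mp hi).2)
    rw [mul_sub, mul_one, ← mul_pow, mul_inv_cancel₀ hne, one_pow]
  rw [prod_eq_prod_norm_trichotomy α, hlarge, unitLeadingCoeff, mul_pow]
  ring

variable [IsUltrametricDist K]

theorem prod_norm_eq_one_eq_mul {M : Type*} [CommMonoid M] (α : ι → K) (F : ι → M) :
    ∏ i with ‖α i‖ = 1, F i = (∏ i with ‖α i‖ = 1 ∧ ‖α i - 1‖ = 1, F i) *
      ∏ i with ‖α i‖ = 1 ∧ ‖α i - 1‖ < 1, F i := by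
  rw [← Finset.filter_filter, ← Finset.filter_filter,
    ← Finset.prod_filter_mul_prod_filter_not _ fun i => ‖α i - 1‖ = 1]
  congr 2
  refine Finset.filter_congr fun i hi => ?_
  exact (norm_sub_one_le_one (Finset.mem_filter.mp hi).2.le).lt_iff_ne.symm

theorem filter_norm_sub_one_lt_one_eq (α : ι → K) :
    ({i | ‖α i - 1‖ < 1} : Finset ι) = ({i | ‖α i‖ = 1 ∧ ‖α i - 1‖ < 1} : Finset ι) :=
  Finset.filter_congr fun _ _ =>
    ⟨fun h => ⟨norm_eq_one_of_norm_sub_one_lt_one h, h⟩, fun h => h.2⟩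

theorem norm_mul_prod_one_sub (b : K) (α : ι → K) :
    ‖b * ∏ i, (1 - α i)‖ = ‖unitLeadingCoeff b α‖ * ∏ i with ‖α i - 1‖ < 1, ‖α i - 1‖ := by
  have hlarge : ∏ i with 1 < ‖α i‖, ‖α i - 1‖ = ∏ i with 1 < ‖α i‖, ‖α i‖ :=
    Finset.prod_congr rfl fun i hi => norm_sub_one_of_one_lt_norm (Finset.mem_filter.mp hi).2
  have hsmall : ∏ i with ‖α i‖ < 1, ‖α i - 1‖ = 1 :=
    Finset.prod_eq_one fun i hi => norm_sub_one_of_norm_lt_one (Finset.mem_filter.mp hi).2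
  have hunit : ∏ i with ‖α i‖ = 1 ∧ ‖α i - 1‖ = 1, ‖α i - 1‖ = 1 :=
    Finset.prod_eq_one fun i hi => (Finset.mem_filter.mp hi).2.2
  simp only [unitLeadingCoeff, norm_mul, norm_prod, norm_sub_rev (1 : K)]
  rw [filter_norm_sub_one_lt_one_eq, prod_eq_prod_norm_trichotomy α, prod_norm_eq_one_eq_mul,
    hlarge, hsmall, hunit, mul_one, one_mul, mul_assoc]

end RootProducts

section Limits

variable {p : ℕ} [hp : Fact p.Prime] {ι : Type*} [Fintype ι]

theorem tendsto_neg_one_pow_prime_pow_mul (D : ℕ) :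
    Tendsto (fun n : ℕ => (-1 : ℂ_[p]) ^ (p ^ n * D)) atTop (𝓝 ((-1) ^ (p * D))) := by
  refine tendsto_const_nhds.congr' ?_
  filter_upwards [eventually_ne_atTop 0] with n hn
  rw [pow_mul, pow_mul]
  rcases hp.out.eq_two_or_odd' with rfl | hodd
  · rw [(even_two.pow_of_ne_zero hn).neg_one_pow, even_two.neg_one_pow]
  · rw [hodd.pow.neg_one_pow, hodd.neg_one_pow]

theorem tendsto_pow_prime_pow_zero {x : ℂ_[p]} (hx : ‖x‖ < 1) :
    Tendsto (fun n : ℕ => x ^ p ^ n) atTop (𝓝 0) :=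
  (tendsto_pow_atTop_nhds_zero_of_norm_lt_one hx).comp
    (tendsto_pow_atTop_atTop_of_one_lt hp.out.one_lt)

theorem tendsto_prod_one_lt_norm (α : ι → ℂ_[p]) :
    Tendsto (fun n : ℕ => ∏ i with 1 < ‖α i‖, (1 - (α i)⁻¹ ^ p ^ n)) atTop (𝓝 1) := by
  have h (i) (hi : i ∈ ({i | 1 < ‖α i‖} : Finset ι)) :
      Tendsto (fun n : ℕ => 1 - (α i)⁻¹ ^ p ^ n) atTop (𝓝 1) := by
    have hlt : ‖(α i)⁻¹‖ < 1 :=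
      (norm_inv _).trans_lt (inv_lt_one_of_one_lt₀ (Finset.mem_filter.mp hi).2)
    simpa using (tendsto_pow_prime_pow_zero hlt).const_sub 1
  simpa using tendsto_finsetProd _ h

theorem tendsto_prod_norm_lt_one (α : ι → ℂ_[p]) :
    Tendsto (fun n : ℕ => ∏ i with ‖α i‖ < 1, (α i ^ p ^ n - 1)) atTop
      (𝓝 ((-1) ^ Finset.card {i | ‖α i‖ < 1})) := by
  rw [← Finset.prod_const]
  refine tendsto_finsetProd _ fun i hi => ?_
  simpa using (tendsto_pow_prime_pow_zero (Finset.mem_filter.mp hi).2).sub_const 1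

theorem tendsto_nonunit_factor (α : ι → ℂ_[p]) {c ξ : ℂ_[p]} (hξ : IsTeichmullerRep p c ξ)
    (hfix : ξ ^ p = ξ) (D : ℕ) :
    Tendsto (fun n : ℕ => (-1) ^ (p ^ n * D) * (c ^ p ^ n *
        (∏ i with 1 < ‖α i‖, (1 - (α i)⁻¹ ^ p ^ n)) * ∏ i with ‖α i‖ < 1, (α i ^ p ^ n - 1)))
      atTop (𝓝 ((-1) ^ (p * D + Finset.card {i | ‖α i‖ < 1}) * ξ)) := by
  convert (tendsto_neg_one_pow_prime_pow_mul D).mul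
    (((hξ.tendsto_pow_prime_pow hfix).mul (tendsto_prod_one_lt_norm α)).mul
      (tendsto_prod_norm_lt_one α)) using 2
  ring

theorem prod_pow_pow_eq_of_perm {K M : Type*} [Monoid K] [CommMonoid M] {S : ι → Prop}
    [DecidablePred S] {ζ : ι → K} {q : ℕ} (σ : Equiv.Perm {i // S i})
    (hσ : ∀ i, ζ (σ i) = ζ i ^ q) (F : K → M) (n : ℕ) :
    ∏ i with S i, F (ζ i ^ q ^ n) = ∏ i with S i, F (ζ i) := by
  have hsubtype (G : ι → M) : ∏ i with S i, G i = ∏ i : {i // S i}, G i :=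
    Finset.prod_subtype _ (by simp) G
  rw [hsubtype, hsubtype]
  induction n with
  | zero => simp
  | succ n ih =>
    rw [← ih, ← Equiv.prod_comp σ fun i : {i // S i} => F (ζ i ^ q ^ n)]
    refine Finset.prod_congr rfl fun i _ => ?_
    rw [hσ, ← pow_mul, pow_succ']

theorem tendsto_prod_pow_prime_pow_sub_one {κ : Type*} {s : Finset κ}
    {α ζ : κ → ℂ_[p]}
    (hζ : ∀ i ∈ s, IsTeichmullerRep p (α i) (ζ i))
    (hprod : ∀ n : ℕ, ∏ i ∈ s, (ζ i ^ p ^ n - 1) = ∏ i ∈ s, (ζ i - 1)) :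
    Tendsto (fun n : ℕ => ∏ i ∈ s, (α i ^ p ^ n - 1)) atTop (𝓝 (∏ i ∈ s, (ζ i - 1))) := by
  have hbound {x : ℂ_[p]} (hx : ‖x‖ = 1) (n : ℕ) : ‖x ^ p ^ n - 1‖ ≤ 1 :=
    norm_sub_one_le_one (by simp [hx])
  have hlim := tendsto_prod_sub_prod_zero s (x := fun i n => α i ^ p ^ n - 1)
    (y := fun i n => ζ i ^ p ^ n - 1) (fun i hi => hbound (hζ i hi).norm_left_eq_one)
    (fun i hi => hbound (hζ i hi).norm_eq_one) fun i hi => by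
      simpa only [sub_sub_sub_cancel_right] using
        tendsto_pow_prime_pow_sub_pow p (hζ i hi).norm_eq_one (hζ i hi).2.2
  simpa only [hprod, sub_add_cancel, zero_add] using hlim.add_const (∏ i ∈ s, (ζ i - 1))

variable {α ζ : ι → ℂ_[p]}

theorem prod_pow_prime_pow_sub_one_eq_of_perm {σ : Equiv.Perm {i // ‖α i‖ = 1}}
    (hσ : ∀ i, ζ (σ i) = ζ i ^ p) (hζ : ∀ i, ‖α i‖ = 1 → IsTeichmullerRep p (α i) (ζ i)) (n : ℕ) :
    ∏ i with ‖α i‖ = 1 ∧ ‖α i - 1‖ = 1, (ζ i ^ p ^ n - 1) =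
      ∏ i with ‖α i‖ = 1 ∧ ‖α i - 1‖ = 1, (ζ i - 1) := by
  classical
  have hite (k : ℕ) : ∏ i with ‖α i‖ = 1 ∧ ‖α i - 1‖ = 1, (ζ i ^ p ^ k - 1) =
      ∏ i with ‖α i‖ = 1, if ζ i ^ p ^ k ≠ 1 then ζ i ^ p ^ k - 1 else 1 := by
    rw [← Finset.filter_filter, Finset.prod_filter fun i => ‖α i - 1‖ = 1]
    refine Finset.prod_congr rfl fun i hi => ?_
    have hi := hζ i (Finset.mem_filter.mp hi).2
    simp only [hi.norm_sub_one_eq_one_iff, Ne, hi.pow_prime_pow_eq_one_iff]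
  have hone := hite 0
  simp only [pow_zero, pow_one] at hone
  rw [hite, hone]
  exact prod_pow_pow_eq_of_perm σ hσ (fun z => if z ≠ 1 then z - 1 else 1) n

/-- The limit of `Res(t^(p^n) - 1, g) / p^(n λ)` for `g` not divisible by `p`, of degree `D` and
with roots `α i`, where `λ` is the number of roots congruent to `1`; `ξ` and `ζ i` are the
Teichmüller representatives of `unitLeadingCoeff` and of the unit roots. -/
noncomputable def normalizedLimit (p : ℕ) [Fact p.Prime] (D : ℕ) (ξ : ℂ_[p]) (α ζ : ι → ℂ_[p]) :
    ℂ_[p] :=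
  (-1) ^ (p * D + Finset.card {i | ‖α i‖ < 1}) * ξ *
    (∏ i with ‖α i‖ = 1 ∧ ‖α i - 1‖ = 1, (ζ i - 1)) *
    ∏ i with ‖α i‖ = 1 ∧ ‖α i - 1‖ < 1, padicComplexLog p (α i)

theorem norm_normalizedLimit {ξ : ℂ_[p]} (hξ : ‖ξ‖ = 1)
    (hζ : ∀ i, ‖α i‖ = 1 → IsTeichmullerRep p (α i) (ζ i)) (D : ℕ) :
    ‖normalizedLimit p D ξ α ζ‖ = ∏ i with ‖α i - 1‖ < 1, ‖padicComplexLog p (α i)‖ := by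
  have hunit : ∏ i with ‖α i‖ = 1 ∧ ‖α i - 1‖ = 1, ‖ζ i - 1‖ = 1 := by
    refine Finset.prod_eq_one fun i hi => ?_
    obtain ⟨h1, h2⟩ := (Finset.mem_filter.mp hi).2
    exact (hζ i h1).self.norm_sub_one_eq_one_iff.mpr ((hζ i h1).norm_sub_one_eq_one_iff.mp h2)
  rw [normalizedLimit, filter_norm_sub_one_lt_one_eq]
  simp only [norm_mul, norm_pow, norm_neg, norm_one, one_pow, one_mul, norm_prod, hξ, hunit]

variable {g : ℤ[X]} {b ξ : ℂ_[p]}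

theorem pow_prime_eq_self_of_isTeichmullerRep (hg : ¬ C (p : ℤ) ∣ g)
    (hfac : g.map (Int.castRingHom ℂ_[p]) = C b * ∏ i, (X - C (α i)))
    (hξ : IsTeichmullerRep p (unitLeadingCoeff b α) ξ) : ξ ^ p = ξ :=
  (hξ.pow p).eq (hξ.congr (frobenius_unitLeadingCoeff_and_unit_roots p hg hfac).1)

theorem exists_perm_eq_pow_prime (hg : ¬ C (p : ℤ) ∣ g)
    (hfac : g.map (Int.castRingHom ℂ_[p]) = C b * ∏ i, (X - C (α i)))
    (hζ : ∀ i, ‖α i‖ = 1 → IsTeichmullerRep p (α i) (ζ i)) :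
    ∃ σ : Equiv.Perm {i // ‖α i‖ = 1}, ∀ i, ζ (σ i) = ζ i ^ p :=
  (frobenius_unitLeadingCoeff_and_unit_roots p hg hfac).2.imp fun _ hσ =>
    teichmullerRep_perm_eq_pow hσ hζ

theorem cyclicResultant_eq_prod_norm_trichotomy (hg : ¬ C (p : ℤ) ∣ g)
    (hfac : g.map (Int.castRingHom ℂ_[p]) = C b * ∏ i, (X - C (α i))) (n : ℕ) :
    (cyclicResultant n g : ℂ_[p]) = (-1) ^ (n * g.natDegree) * (unitLeadingCoeff b α ^ n *
      (∏ i with 1 < ‖α i‖, (1 - (α i)⁻¹ ^ n)) * ∏ i with ‖α i‖ < 1, (α i ^ n - 1)) *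
        ∏ i with ‖α i‖ = 1, (α i ^ n - 1) := by
  have := charZero_of_normedAlgebra_padic ℂ_[p] p
  have hg0 : g ≠ 0 := fun h => hg (h ▸ dvd_zero _)
  rw [cyclicResultant_eq_prod hg0 hfac, pow_mul_prod_pow_sub_one, ← mul_assoc]

theorem tendsto_cyclicResultant (hg : ¬ C (p : ℤ) ∣ g)
    (hfac : g.map (Int.castRingHom ℂ_[p]) = C b * ∏ i, (X - C (α i)))
    (hξ : IsTeichmullerRep p (unitLeadingCoeff b α) ξ)
    (hζ : ∀ i, ‖α i‖ = 1 → IsTeichmullerRep p (α i) (ζ i)) :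
    Tendsto (fun n : ℕ => (cyclicResultant (p ^ n) g : ℂ_[p])) atTop
      (𝓝 ((-1) ^ (p * g.natDegree + Finset.card {i | ‖α i‖ < 1}) * ξ *
        ∏ i with ‖α i‖ = 1, (ζ i - 1))) := by
  obtain ⟨σ, hσ⟩ := exists_perm_eq_pow_prime hg hfac hζ
  simp_rw [cyclicResultant_eq_prod_norm_trichotomy hg hfac]
  exact (tendsto_nonunit_factor α hξ (pow_prime_eq_self_of_isTeichmullerRep hg hfac hξ) _).mul
    (tendsto_prod_pow_prime_pow_sub_one (fun i hi => hζ i (Finset.mem_filter.mp hi).2)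
      (prod_pow_pow_eq_of_perm σ hσ fun z => z - 1))

theorem tendsto_cyclicResultant_div (hg : ¬ C (p : ℤ) ∣ g)
    (hfac : g.map (Int.castRingHom ℂ_[p]) = C b * ∏ i, (X - C (α i)))
    (hξ : IsTeichmullerRep p (unitLeadingCoeff b α) ξ)
    (hζ : ∀ i, ‖α i‖ = 1 → IsTeichmullerRep p (α i) (ζ i)) :
    Tendsto (fun n : ℕ => (cyclicResultant (p ^ n) g : ℂ_[p]) /
        (p : ℂ_[p]) ^ (n * Finset.card {i | ‖α i - 1‖ < 1})) atTop
      (𝓝 (normalizedLimit p g.natDegree ξ α ζ)) := by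
  obtain ⟨σ, hσ⟩ := exists_perm_eq_pow_prime hg hfac hζ
  have hlog : Tendsto (fun n : ℕ => ∏ i with ‖α i‖ = 1 ∧ ‖α i - 1‖ < 1,
      ((α i ^ p ^ n - 1) / (p : ℂ_[p]) ^ n)) atTop
      (𝓝 (∏ i with ‖α i‖ = 1 ∧ ‖α i - 1‖ < 1, padicComplexLog p (α i))) :=
    tendsto_finsetProd _ fun i hi =>
      tendsto_pow_prime_pow_sub_one_div p (Finset.mem_filter.mp hi).2.2
  refine (((tendsto_nonunit_factor α hξ (pow_prime_eq_self_of_isTeichmullerRep hg hfac hξ) _).mul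
    (tendsto_prod_pow_prime_pow_sub_one (fun i hi => hζ i (Finset.mem_filter.mp hi).2.1)
      (prod_pow_prime_pow_sub_one_eq_of_perm hσ hζ))).mul hlog).congr fun n => ?_
  rw [cyclicResultant_eq_prod_norm_trichotomy hg hfac, prod_norm_eq_one_eq_mul,
    Finset.prod_div_distrib, Finset.prod_const, ← pow_mul, filter_norm_sub_one_lt_one_eq]
  ring

theorem normalizedLimit_ne_zero (hg : ¬ C (p : ℤ) ∣ g)
    (hfac : g.map (Int.castRingHom ℂ_[p]) = C b * ∏ i, (X - C (α i))) (hξ : ‖ξ‖ = 1)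
    (hζ : ∀ i, ‖α i‖ = 1 → IsTeichmullerRep p (α i) (ζ i))
    (hres : ∀ n : ℕ, cyclicResultant (p ^ n) g ≠ 0) (D : ℕ) :
    normalizedLimit p D ξ α ζ ≠ 0 := by
  have := charZero_of_normedAlgebra_padic ℂ_[p] p
  have hg0 : g ≠ 0 := fun h => hg (h ▸ dvd_zero _)
  have hroot (i : ι) (n : ℕ) : α i ^ p ^ n ≠ 1 := by
    intro hone
    refine hres n ((Int.cast_eq_zero (α := ℂ_[p])).mp ?_)
    rw [cyclicResultant_eq_prod hg0 hfac,
      Finset.prod_eq_zero (Finset.mem_univ i) (sub_eq_zero.mpr hone), mul_zero, mul_zero]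
  rw [← norm_ne_zero_iff, norm_normalizedLimit hξ hζ, Finset.prod_ne_zero_iff]
  exact fun i hi => norm_ne_zero_iff.mpr
    (padicLog_ne_zero p (Finset.mem_filter.mp hi).2 (hroot i))

theorem norm_eval_one_eq_prod_norm_log (hg : ¬ C (p : ℤ) ∣ g)
    (hfac : g.map (Int.castRingHom ℂ_[p]) = C b * ∏ i, (X - C (α i)))
    (hsmall : ∀ i, ‖α i - 1‖ < 1 → ‖α i - 1‖ < (p : ℝ) ^ (-1 / ((p : ℝ) - 1))) :
    ‖((g.eval 1 : ℤ) : ℚ_[p])‖ = ∏ i with ‖α i - 1‖ < 1, ‖padicComplexLog p (α i)‖ := by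
  have heval : ((g.eval 1 : ℤ) : ℂ_[p]) = b * ∏ i, (1 - α i) := by
    have h := congrArg (eval 1) hfac
    rwa [eval_one_map, eq_intCast, eval_mul, eval_C, eval_prod,
      Finset.prod_congr rfl fun i _ => by rw [eval_sub, eval_X, eval_C]] at h
  rw [← norm_intCast_eq_padicNorm ℂ_[p] p, heval, norm_mul_prod_one_sub,
    norm_unitLeadingCoeff_eq_one p hg hfac, one_mul]
  exact Finset.prod_congr rfl fun i hi => (norm_padicLog_eq p
    (pow_pred_lt_inv_of_lt_rpow (norm_nonneg _) (hsmall i (Finset.mem_filter.mp hi).2))).symm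

end Limits

section PrimitivePolynomial

variable {p : ℕ} [hp : Fact p.Prime] {ι : Type*} [Fintype ι] {g : ℤ[X]} {b ξ : ℂ_[p]}
  {α ζ : ι → ℂ_[p]}

theorem existsUnique_isTeichmullerRep_unitLeadingCoeff (hg : ¬ C (p : ℤ) ∣ g)
    (hfac : g.map (Int.castRingHom ℂ_[p]) = C b * ∏ i, (X - C (α i))) :
    ∃! ξ, IsTeichmullerRep p (unitLeadingCoeff b α) ξ :=
  existsUnique_isTeichmullerRep one_ne_zero (norm_unitLeadingCoeff_eq_one p hg hfac)
    (by simpa only [pow_one] using (frobenius_unitLeadingCoeff_and_unit_roots p hg hfac).1)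

theorem existsUnique_isTeichmullerRep_root (hg : ¬ C (p : ℤ) ∣ g)
    (hfac : g.map (Int.castRingHom ℂ_[p]) = C b * ∏ i, (X - C (α i))) {i : ι} (hi : ‖α i‖ = 1) :
    ∃! z, IsTeichmullerRep p (α i) z :=
  let ⟨_, hσ⟩ := (frobenius_unitLeadingCoeff_and_unit_roots p hg hfac).2
  existsUnique_isTeichmullerRep_of_perm hσ i hi

theorem exists_padicInt_tendsto_cyclicResultant (hg : ¬ C (p : ℤ) ∣ g)
    (hfac : g.map (Int.castRingHom ℂ_[p]) = C b * ∏ i, (X - C (α i)))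
    (hξ : IsTeichmullerRep p (unitLeadingCoeff b α) ξ)
    (hζ : ∀ i, ‖α i‖ = 1 → IsTeichmullerRep p (α i) (ζ i)) :
    ∃ L : ℤ_[p], Tendsto (fun n : ℕ => (cyclicResultant (p ^ n) g : ℤ_[p])) atTop (𝓝 L) ∧
      algebraMap ℚ_[p] ℂ_[p] (L : ℚ_[p]) =
        (-1) ^ (p * g.natDegree + Finset.card {i | ‖α i‖ < 1}) * ξ *
          ∏ i with ‖α i‖ = 1, (ζ i - 1) ∧
      (L = 0 ↔ ∃ i, ‖α i‖ = 1 ∧ ζ i = 1) := by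
  obtain ⟨L, hL, hLeq⟩ := exists_padicInt_tendsto (tendsto_cyclicResultant hg hfac hξ hζ)
  refine ⟨L, hL, hLeq, ?_⟩
  have hunit : (-1) ^ (p * g.natDegree + Finset.card {i | ‖α i‖ < 1}) * ξ ≠ 0 :=
    mul_ne_zero (pow_ne_zero _ (neg_ne_zero.mpr one_ne_zero)) hξ.ne_zero
  calc L = 0 ↔ algebraMap ℚ_[p] ℂ_[p] (L : ℚ_[p]) = 0 := by rw [map_eq_zero, PadicInt.coe_eq_zero]
    _ ↔ ∃ i, ‖α i‖ = 1 ∧ ζ i = 1 := by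
      rw [hLeq, mul_eq_zero_iff_left hunit, Finset.prod_eq_zero_iff]
      simp only [Finset.mem_filter, Finset.mem_univ, true_and, sub_eq_zero]

theorem exists_padicInt_tendsto_nonPPart_cyclicResultant (hg : ¬ C (p : ℤ) ∣ g)
    (hfac : g.map (Int.castRingHom ℂ_[p]) = C b * ∏ i, (X - C (α i)))
    (hξ : IsTeichmullerRep p (unitLeadingCoeff b α) ξ)
    (hζ : ∀ i, ‖α i‖ = 1 → IsTeichmullerRep p (α i) (ζ i)) {ν : ℤ}
    (hν : ‖normalizedLimit p g.natDegree ξ α ζ‖ = (p : ℝ) ^ (-ν)) :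
    ∃ L : ℤ_[p],
      Tendsto (fun n : ℕ => (nonPPart p (cyclicResultant (p ^ n) g) : ℤ_[p])) atTop (𝓝 L) ∧
      algebraMap ℚ_[p] ℂ_[p] (L : ℚ_[p]) =
        (-1) ^ (p * g.natDegree + Finset.card {i | ‖α i‖ < 1}) * ξ *
          (∏ i with ‖α i‖ = 1 ∧ ‖α i - 1‖ = 1, (ζ i - 1)) * (p : ℂ_[p]) ^ (-ν) *
          ∏ i with ‖α i‖ = 1 ∧ ‖α i - 1‖ < 1, padicComplexLog p (α i) := by
  obtain ⟨L, hL, hLeq⟩ := exists_padicInt_tendsto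
    (tendsto_nonPPart hν (tendsto_cyclicResultant_div hg hfac hξ hζ))
  exact ⟨L, hL, by rw [hLeq, normalizedLimit, mul_right_comm]⟩

theorem isIwasawaInvariants_of_norm_normalizedLimit_eq (hg : ¬ C (p : ℤ) ∣ g)
    (hfac : g.map (Int.castRingHom ℂ_[p]) = C b * ∏ i, (X - C (α i)))
    (hξ : IsTeichmullerRep p (unitLeadingCoeff b α) ξ)
    (hζ : ∀ i, ‖α i‖ = 1 → IsTeichmullerRep p (α i) (ζ i)) {ν : ℤ}
    (hν : ‖normalizedLimit p g.natDegree ξ α ζ‖ = (p : ℝ) ^ (-ν)) :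
    IsIwasawaInvariants p g (Finset.card {i | ‖α i - 1‖ < 1}) 0 ν := by
  filter_upwards [eventually_norm_intCast_eq_zpow hν (tendsto_cyclicResultant_div hg hfac hξ hζ)]
    with n hn
  rw [← norm_intCast_eq_padicNorm ℂ_[p] p, hn, zpow_neg, inv_inv, Nat.cast_zero, zero_mul, add_zero]

theorem exists_norm_normalizedLimit_eq_zpow (hg : ¬ C (p : ℤ) ∣ g)
    (hfac : g.map (Int.castRingHom ℂ_[p]) = C b * ∏ i, (X - C (α i)))
    (hξ : IsTeichmullerRep p (unitLeadingCoeff b α) ξ)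
    (hζ : ∀ i, ‖α i‖ = 1 → IsTeichmullerRep p (α i) (ζ i))
    (hres : ∀ n : ℕ, cyclicResultant (p ^ n) g ≠ 0) :
    ∃ ν : ℤ, ‖normalizedLimit p g.natDegree ξ α ζ‖ = (p : ℝ) ^ (-ν) :=
  exists_norm_eq_prime_zpow (normalizedLimit_ne_zero hg hfac hξ.norm_eq_one hζ hres _)
    (tendsto_cyclicResultant_div hg hfac hξ hζ)

end PrimitivePolynomial

theorem theorem4p6 (p : ℕ) [Fact p.Prime]
    -- the fixed embedding of the algebraic closure of `ℚ` into `ℂ_p`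
    (ι : AlgebraicClosure ℚ →+* ℂ_[p])
    (f : ℤ[X]) (hf : f ≠ 0)
    -- `p ^ μ` is the maximal power of `p` dividing `f`
    (μ : ℕ) (hμ : (C (p : ℤ)) ^ μ ∣ f) (hμ' : ¬ (C (p : ℤ)) ^ (μ + 1) ∣ f)
    -- `f = a₀ ∏ (t - α i)` over the algebraic closure of `ℚ`
    (d : ℕ) (a₀ : AlgebraicClosure ℚ) (α : Fin d → AlgebraicClosure ℚ)
    (hfac : f.map (Int.castRingHom (AlgebraicClosure ℚ)) = C a₀ * ∏ i, (X - C (α i))) :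
    -- existence and uniqueness of `ξ` and of the `ζ i`
    ‖(p : ℂ_[p]) ^ (-(μ : ℤ)) * ι a₀ * ∏ i with 1 < ‖ι (α i)‖, ι (α i)‖ = 1 ∧
    (∃! ξ : ℂ_[p], IsTeichmullerRep p
      ((p : ℂ_[p]) ^ (-(μ : ℤ)) * ι a₀ * ∏ i with 1 < ‖ι (α i)‖, ι (α i)) ξ) ∧
    (∀ i, ‖ι (α i)‖ = 1 → ∃! z : ℂ_[p], IsTeichmullerRep p (ι (α i)) z) ∧
    ∀ (ξ : ℂ_[p]) (ζ : Fin d → ℂ_[p]),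
      IsTeichmullerRep p
        ((p : ℂ_[p]) ^ (-(μ : ℤ)) * ι a₀ * ∏ i with 1 < ‖ι (α i)‖, ι (α i)) ξ →
      (∀ i, ‖ι (α i)‖ = 1 → IsTeichmullerRep p (ι (α i)) (ζ i)) →
      -- (1)(i)
      (C (p : ℤ) ∣ f →
        Tendsto (fun n : ℕ => ((cyclicResultant (p ^ n) f : ℤ) : ℤ_[p])) atTop (𝓝 0)) ∧
      -- (1)(ii)
      (¬ C (p : ℤ) ∣ f → ∃ L : ℤ_[p],
        Tendsto (fun n : ℕ => ((cyclicResultant (p ^ n) f : ℤ) : ℤ_[p])) atTop (𝓝 L) ∧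
        algebraMap ℚ_[p] ℂ_[p] (L : ℚ_[p]) =
          (-1) ^ (p * f.natDegree + Finset.card {i | ‖ι (α i)‖ < 1}) * ξ *
            ∏ i with ‖ι (α i)‖ = 1, (ζ i - 1) ∧
        (L = 0 ↔ ∃ i, ‖ι (α i)‖ = 1 ∧ ζ i = 1)) ∧
      -- (2) and the Iwasawa invariants
      ((∀ n : ℕ, cyclicResultant (p ^ n) f ≠ 0) → ∃ ν : ℤ,
        (p : ℝ) ^ (-ν) = ∏ i with ‖ι (α i) - 1‖ < 1, ‖padicComplexLog p (ι (α i))‖ ∧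
        (∃ L : ℤ_[p],
          Tendsto (fun n : ℕ => ((nonPPart p (cyclicResultant (p ^ n) f) : ℤ) : ℤ_[p]))
            atTop (𝓝 L) ∧
          algebraMap ℚ_[p] ℂ_[p] (L : ℚ_[p]) =
            (-1) ^ (p * f.natDegree + Finset.card {i | ‖ι (α i)‖ < 1}) * ξ *
              (∏ i with ‖ι (α i)‖ = 1 ∧ ‖ι (α i) - 1‖ = 1, (ζ i - 1)) *
              (p : ℂ_[p]) ^ (-ν) *
              ∏ i with ‖ι (α i)‖ = 1 ∧ ‖ι (α i) - 1‖ < 1, padicComplexLog p (ι (α i))) ∧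
        ((∀ i, ‖ι (α i) - 1‖ < 1 → ‖ι (α i) - 1‖ < (p : ℝ) ^ (-1 / ((p : ℝ) - 1))) →
          (p : ℝ) ^ ν = ‖(p : ℚ_[p]) ^ (-(μ : ℤ)) * ((f.eval 1 : ℤ) : ℚ_[p])‖⁻¹) ∧
        IsIwasawaInvariants p f (Finset.card {i | ‖ι (α i) - 1‖ < 1}) μ ν) := by
  have := charZero_of_normedAlgebra_padic ℂ_[p] p
  obtain ⟨g, rfl⟩ := hμ
  have hg : ¬ C (p : ℤ) ∣ g := fun h => hμ' (pow_succ (C (p : ℤ)) μ ▸ mul_dvd_mul_left _ h)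
  have hfacg := map_intCast_eq_of_map_prime_pow_mul_eq (map_intCast_eq_prod_of_ringHom ι hfac)
  refine ⟨norm_unitLeadingCoeff_eq_one p hg hfacg,
    existsUnique_isTeichmullerRep_unitLeadingCoeff hg hfacg,
    fun i hi => existsUnique_isTeichmullerRep_root hg hfacg hi, fun ξ ζ hξ hζ =>
      ⟨tendsto_cyclicResultant_zero_of_dvd, fun hndvd => ?_, fun hres => ?_⟩⟩
  · have hμ0 : μ = 0 := by_contra fun h => hndvd ((dvd_pow_self _ h).mul_right g)
    subst hμ0
    simpa only [pow_zero, one_mul] using exists_padicInt_tendsto_cyclicResultant hg hfacg hξ hζ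
  · simp only [cyclicResultant_C_prime_pow_mul, nonPPart_prime_pow_mul, natDegree_C_prime_pow_mul,
      prime_zpow_neg_mul_eval_one] at hres ⊢
    obtain ⟨ν, hν⟩ := exists_norm_normalizedLimit_eq_zpow hg hfacg hξ hζ fun n =>
      right_ne_zero_of_mul (hres n)
    have hlog := hν.symm.trans (norm_normalizedLimit hξ.norm_eq_one hζ _)
    refine ⟨ν, hlog, exists_padicInt_tendsto_nonPPart_cyclicResultant hg hfacg hξ hζ hν,
      fun hsmall => ?_,
      (isIwasawaInvariants_of_norm_normalizedLimit_eq hg hfacg hξ hζ hν).prime_pow_mul μ⟩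
    rw [norm_eval_one_eq_prod_norm_log hg hfacg hsmall, ← hlog, zpow_neg, inv_inv]
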